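/- Let $c>0$, $\alpha\in\mathbb R$, $\beta:\mathbb Z\to\mathbb R$, and let $C_\lambda=C_\mu>0$. For $L,M\in\mathbb R$ put $$\lambda_n=\beta(n)e^{-c(n-L)},\qquad \mu_n=\beta(n-1)e^{c(n-M)},\qquad n\in\mathbb Z,$$ and consider, for $X(t)=(L(t),M(t),p(t))$ with $p(t)=(p_n(t))_{n\in\mathbb Z}$, $t\ge 0$, the system $$\frac{dp_n}{dt}=\lambda_{n-1}p_{n-1}-(\lambda_n+\mu_n)p_n+\mu_{n+1}p_{n+1}\quad(n\in\mathbb Z),$$ $$\frac{dL}{dt}=-\sum_{n\in\mathbb Z}p_n\lambda_n+C_\lambda,\qquad \frac{dM}{dt}=\sum_{n\in\mathbb Z}p_n\mu_n-C_\mu .$$ Let $\mathbf B$ be the Banach space of real sequences $p$ with $$\|p\|_\alpha=\sum_{n\in\mathbb Z}|p_n|\,e^{c n^2/2+\alpha|n|}<\infty ,$$ and let $K(X)=L+M+\sum_{n\in\mathbb Z}n\,p_n$. A solution is a curve $X$ on $[0,\infty)$ satisfying the system for all $t\ge0$ and such that $t\mapsto p(t)$ is a continuous map into $\mathbf B$.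 A fixed point is a triple $(L,M,p)$ with $p$ a probability measure on $\mathbb Z$, for which the two series in the system converge absolutely and all right-hand sides vanish. Theorem 4. Assume that $$\sup_n\beta(n)<\infty,\qquad \inf_n\beta(n)>0,$$ and that there is a constant $C>0$ such that for all $n\in\mathbb Z$ $$e^{-c}\beta(n+1)-\beta(n)<-C,\qquad e^{-c}\beta(n-1)-\beta(n)<-C .$$ Let $X(0)=(L(0),M(0),p(0))$, where $L(0),M(0)\in\mathbb R$ are arbitrary and $p(0)\in\mathbf B$ is a probability measure. Then there is exactly one fixed point $X^*=(L^*,M^*,p^*)$ with $K(X^*)=K(X(0))$; it satisfies $p^*\in\mathbf B$, and the solution $X(t)$ of the system with initial point $X(0)$ converges to it as $t\to\infty$: $$\|p(t)-p^*\|_\alpha\to0,\qquad L(t)\to L^*,\qquad M(t)\to M^* .$$ -/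

import Mathlib

open Filter Topology

noncomputable section

/-- A point `X = (L, M, (p n)_{n ∈ ℤ})` of the phase space. -/
@[ext]
structure WalkState where
  L : ℝ
  M : ℝ
  p : ℤ → ℝ

/-- The rate `β(n) e^{-c (n - L)}` of the jump `n → n + 1`. -/
def rateUp (c : ℝ) (β : ℤ → ℝ) (L : ℝ) (n : ℤ) : ℝ :=
  β n * Real.exp (-c * ((n : ℝ) - L))

/-- The rate `β(n - 1) e^{c (n - M)}` of the jump `n → n - 1`. -/
def rateDown (c : ℝ) (β : ℤ → ℝ) (M : ℝ) (n : ℤ) : ℝ :=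
  β (n - 1) * Real.exp (c * ((n : ℝ) - M))

/-- Right-hand side of the equation for `dp_n/dt`. -/
def fieldP (c : ℝ) (β : ℤ → ℝ) (x : WalkState) (n : ℤ) : ℝ :=
  rateUp c β x.L (n - 1) * x.p (n - 1)
    - (rateUp c β x.L n + rateDown c β x.M n) * x.p n
    + rateDown c β x.M (n + 1) * x.p (n + 1)

/-- Right-hand side of the equation for `dL/dt`. -/
def fieldL (c : ℝ) (β : ℤ → ℝ) (Clam : ℝ) (x : WalkState) : ℝ :=
  -(∑' n : ℤ, x.p n * rateUp c β x.L n) + Clam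

/-- Right-hand side of the equation for `dM/dt`. -/
def fieldM (c : ℝ) (β : ℤ → ℝ) (Cmu : ℝ) (x : WalkState) : ℝ :=
  (∑' n : ℤ, x.p n * rateDown c β x.M n) - Cmu

/-- The weight `exp (c n² / 2 + α |n|)`; for `c = 1` it is `exp (n² / 2 + α |n|)`. -/
def weightB (c α : ℝ) (n : ℤ) : ℝ :=
  Real.exp (c * (n : ℝ) ^ 2 / 2 + α * |(n : ℝ)|)

/-- Membership in the Banach space `𝐁` of sequences with finite weighted `ℓ¹` norm. -/
def MemB (c α : ℝ) (q : ℤ → ℝ) : Prop :=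
  Summable fun n : ℤ => |q n| * weightB c α n

/-- The norm of `𝐁` (meaningful on sequences satisfying `MemB`). -/
def normB (c α : ℝ) (q : ℤ → ℝ) : ℝ :=
  ∑' n : ℤ, |q n| * weightB c α n

/-- `q` is a probability measure on `ℤ`. -/
def IsProbVec (q : ℤ → ℝ) : Prop :=
  (∀ n, 0 ≤ q n) ∧ HasSum q 1

/-- `X` is a solution on `[0, ∞)`: a continuous curve `t ↦ p(t)` in `𝐁` together with functions
`L`, `M`, satisfying the infinite system of differential equations (one-sided derivatives at `0`).
Neither positivity nor normalisation of `p(t)` is required. When `β` is bounded, the series in the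
equations for `L` and `M` converge absolutely because `p(t)` lies in `𝐁`. -/
structure IsSolution (c α : ℝ) (β : ℤ → ℝ) (Clam Cmu : ℝ) (X : ℝ → WalkState) : Prop where
  memB : ∀ t, 0 ≤ t → MemB c α (X t).p
  continuous : ∀ t, 0 ≤ t →
    Tendsto (fun u => normB c α ((X u).p - (X t).p)) (𝓝[Set.Ici 0] t) (𝓝 0)
  deriv_p : ∀ t, 0 ≤ t → ∀ n : ℤ,
    HasDerivWithinAt (fun u => (X u).p n) (fieldP c β (X t) n) (Set.Ici 0) t
  deriv_L : ∀ t, 0 ≤ t →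
    HasDerivWithinAt (fun u => (X u).L) (fieldL c β Clam (X t)) (Set.Ici 0) t
  deriv_M : ∀ t, 0 ≤ t →
    HasDerivWithinAt (fun u => (X u).M) (fieldM c β Cmu (X t)) (Set.Ici 0) t

/-- `x` is a fixed point of the system: its third component is a probability measure, the series in
the equations converge, and all right-hand sides vanish at `x`. -/
structure IsFixedPoint (c : ℝ) (β : ℤ → ℝ) (Clam Cmu : ℝ) (x : WalkState) : Prop where
  prob : IsProbVec x.p
  summable_up : Summable fun n : ℤ => x.p n * rateUp c β x.L n
  summable_down : Summable fun n : ℤ => x.p n * rateDown c β x.M n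
  field_p : ∀ n : ℤ, fieldP c β x n = 0
  field_L : fieldL c β Clam x = 0
  field_M : fieldM c β Cmu x = 0

/-- The quantity `K(X) = L + M + ∑ n p_n`. -/
def conservedK (x : WalkState) : ℝ :=
  x.L + x.M + ∑' n : ℤ, (n : ℝ) * x.p n

/-- `β` is bounded above. -/
def ConBounded (β : ℤ → ℝ) : Prop :=
  BddAbove (Set.range β)

/-- `β` is bounded below by a positive constant, and for some `C > 0` one has
`e^{-c} β(n + 1) - β(n) < -C` and `e^{-c} β(n - 1) - β(n) < -C` for all `n`. -/
def ConDrift (c : ℝ) (β : ℤ → ℝ) : Prop :=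
  (∃ b : ℝ, 0 < b ∧ ∀ n, b ≤ β n) ∧
    ∃ C : ℝ, 0 < C ∧ ∀ n : ℤ,
      Real.exp (-c) * β (n + 1) - β n < -C ∧ Real.exp (-c) * β (n - 1) - β n < -C

end

noncomputable section

/-! ### Comparison principles on the real line -/

/-! Both jumps across the edge between n and n + 1 carry the same factor β(n), so the ratio of their
rates depends only on n and L + M. Hence vanishing fluxes force p to be a discrete Gaussian
determined by L + M. Since L + M decreases at the rate of the total flux, adding c(L + M)²/2 to the
entropy of p relative to exp(-cn²) gives a Lyapunov functional. Its decay is a sum over edges of (x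
- y)(log x - log y), where x and y are the two one-way fluxes (`dissipation_eq`). As the functional
is bounded below and fluxes are Lipschitz in time, every flux tends to zero
(`BoundedFlow.tendsto_flux`).

This needs compactness. The drift condition gives the mean rates a quadratic damping, from which
`IsSolution.exists_bounds` bounds L and M. Bounded L and M make the exit rate from far sites
arbitrarily large, while the quadratic weight keeps the weighted inflow comparable to the norm. This
bounds the norm and makes the tails uniformly small (`IsSolution.exists_normB_le`,
`IsSolution.exists_tail_le`). Positivity of p, needed throughout, follows from mass conservation and
the ℓ¹ contraction `IsSolution.tsum_abs_p_le`.

Limit points are thus in detailed balance and carry the conserved value of K, which determines p and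
L + M (`eq_of_flux_eq_zero`). So these converge, p in norm by tightness. The difference L - M is
invisible to the Lyapunov functional and to detailed balance (`flux_translate`). It is recovered
from a stable linear equation for exp(-cL), forced by a moment of p (`BoundedFlow.tendsto_L`). -/

lemma sub_le_of_hasDerivAt_le {f f' : ℝ → ℝ} {a b C : ℝ} (hab : a ≤ b)
    (hc : ContinuousOn f (Set.Icc a b)) (hd : ∀ t ∈ Set.Ioo a b, HasDerivAt f (f' t) t)
    (h : ∀ t ∈ Set.Ioo a b, f' t ≤ C) : f b - f a ≤ C * (b - a) := by
  rcases hab.eq_or_lt with rfl | hlt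
  · simp
  obtain ⟨x, hx, hfx⟩ := exists_hasDerivAt_eq_slope f f' hlt hc hd
  have h1 := h x hx
  rw [hfx, div_le_iff₀ (by linarith)] at h1
  exact h1

lemma eq_of_hasDerivAt_zero {f : ℝ → ℝ} {a b : ℝ} (hab : a ≤ b)
    (hc : ContinuousOn f (Set.Icc a b)) (hd : ∀ t ∈ Set.Ioo a b, HasDerivAt f 0 t) :
    f b = f a := by
  rcases hab.eq_or_lt with rfl | hlt
  · rfl
  obtain ⟨x, -, hfx⟩ := exists_hasDerivAt_eq_slope f (fun _ => 0) hlt hc hd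
  have h2 : b - a ≠ 0 := by linarith
  field_simp at hfx
  linarith

/-- Grönwall: the excess f - b/a times the integrating factor exp(a(u - s)) is nonincreasing. -/
lemma le_of_hasDerivAt_le_affine {f f' : ℝ → ℝ} {a b s t : ℝ} (ha : 0 < a) (hst : s ≤ t)
    (hd : ∀ u ∈ Set.Icc s t, HasDerivAt f (f' u) u)
    (h : ∀ u ∈ Set.Icc s t, f' u ≤ b - a * f u) :
    f t ≤ b / a + (f s - b / a) * Real.exp (-a * (t - s)) := by
  have hg : ∀ u ∈ Set.Icc s t, HasDerivAt (fun u => (f u - b / a) * Real.exp (a * (u - s)))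
      ((f' u + a * (f u - b / a)) * Real.exp (a * (u - s))) u := by
    intro u hu
    have h1 : HasDerivAt (fun u : ℝ => Real.exp (a * (u - s)))
        (Real.exp (a * (u - s)) * (a * 1)) u :=
      (((hasDerivAt_id u).sub_const s).const_mul a).exp
    refine (((hd u hu).sub_const (b / a)).mul h1).congr_deriv ?_
    ring
  have key := sub_le_of_hasDerivAt_le (C := 0) hst
    (fun u hu => (hg u hu).continuousAt.continuousWithinAt)
    (fun u hu => hg u (Set.Ioo_subset_Icc_self hu)) (by
      intro u hu
      have h1 := h u (Set.Ioo_subset_Icc_self hu)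
      have h2 : a * (b / a) = b := by field_simp
      refine mul_nonpos_of_nonpos_of_nonneg ?_ (Real.exp_pos _).le
      linarith [mul_sub a (f u) (b / a)])
  simp only [sub_self, mul_zero, Real.exp_zero, mul_one, zero_mul] at key
  have h3 : Real.exp (-a * (t - s)) * Real.exp (a * (t - s)) = 1 := by
    rw [← Real.exp_add]; simp
  have h4 : (f t - b / a) = (f t - b / a) * Real.exp (a * (t - s)) * Real.exp (-a * (t - s)) := by
    rw [mul_assoc, mul_comm (Real.exp (a * (t - s))), h3, mul_one]
  have h5 : (f t - b / a) * Real.exp (a * (t - s)) * Real.exp (-a * (t - s))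
      ≤ (f s - b / a) * Real.exp (-a * (t - s)) :=
    mul_le_mul_of_nonneg_right (by linarith) (Real.exp_pos _).le
  linarith

/-- The derivative has to be controlled only at contact with the level R. This is what makes it
usable for coupled quantities. -/
lemma le_of_hasDerivAt_neg_at_barrier {f f' : ℝ → ℝ} {s R : ℝ} (hs : f s ≤ R)
    (hd : ∀ u, s ≤ u → HasDerivAt f (f' u) u) (h : ∀ u, s ≤ u → f u = R → f' u < 0)
    {t : ℝ} (ht : s ≤ t) : f t ≤ R :=
  image_le_of_deriv_right_lt_deriv_boundary (f' := f') (B := fun _ => R) (B' := fun _ => 0)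
    (fun u hu => (hd u hu.1).continuousAt.continuousWithinAt)
    (fun u hu => (hd u hu.1).hasDerivWithinAt) hs (fun u => hasDerivAt_const u R)
    (fun u hu => h u hu.1) ⟨ht, le_rfl⟩

/-- Solutions of `y' = -a y + f` follow the limit of the forcing term. -/
lemma tendsto_of_hasDerivAt_affine {y f : ℝ → ℝ} {a l : ℝ} (ha : 0 < a)
    (hd : ∀ t, 0 < t → HasDerivAt y (-(a * y t) + f t) t) (hf : Tendsto f atTop (𝓝 l)) :
    Tendsto y atTop (𝓝 (l / a)) := by
  rw [Metric.tendsto_atTop]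
  intro ε hε
  -- Forcing within aε/2 of l puts the equilibrium within ε/2 of l/a. The other ε/2 pays for the
  -- transient.
  obtain ⟨t₀, ht₀⟩ := Metric.tendsto_atTop.1 hf (a * ε / 2) (by positivity)
  set s := max t₀ 1
  have hs : ∀ u, s ≤ u → 0 < u ∧ |f u - l| < a * ε / 2 := fun u hu =>
    ⟨lt_of_lt_of_le one_pos ((le_max_right _ _).trans hu), by
      simpa [Real.dist_eq] using ht₀ u ((le_max_left _ _).trans hu)⟩
  have hexp : Tendsto (fun t => (|y s - l / a| + ε / 2) * Real.exp (-a * (t - s))) atTop (𝓝 0) := by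
    have h1 : Tendsto (fun t => -a * (t - s)) atTop atBot := by
      apply Tendsto.const_mul_atTop_of_neg (by linarith)
      exact tendsto_atTop_add_const_right _ _ tendsto_id
    simpa using (Real.tendsto_exp_atBot.comp h1).const_mul (|y s - l / a| + ε / 2)
  obtain ⟨t₁, ht₁⟩ := Metric.tendsto_atTop.1 hexp (ε / 2) (by positivity)
  refine ⟨max t₁ s, fun t ht => ?_⟩
  have hst : s ≤ t := (le_max_right _ _).trans ht
  have hsm := ht₁ t ((le_max_left _ _).trans ht)
  rw [Real.dist_eq, sub_zero, abs_of_nonneg (by positivity)] at hsm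
  have e0 := Real.exp_pos (-a * (t - s))
  have hup := le_of_hasDerivAt_le_affine (b := l + a * ε / 2) ha hst
    (fun u hu => hd u (hs u hu.1).1) (fun u hu => by
      have := (abs_lt.1 (hs u hu.1).2).2; linarith)
  have hlo := le_of_hasDerivAt_le_affine (f := fun u => -y u) (b := -l + a * ε / 2) ha hst
    (fun u hu => (hd u (hs u hu.1).1).neg) (fun u hu => by
      have := (abs_lt.1 (hs u hu.1).2).1; linarith)
  have e1 : (l + a * ε / 2) / a = l / a + ε / 2 := by field_simp
  have e2 : (-l + a * ε / 2) / a = -(l / a) + ε / 2 := by field_simp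
  rw [e1] at hup
  rw [e2] at hlo
  have b1 : (y s - (l / a + ε / 2)) * Real.exp (-a * (t - s))
      ≤ (|y s - l / a| + ε / 2) * Real.exp (-a * (t - s)) :=
    mul_le_mul_of_nonneg_right (by linarith [le_abs_self (y s - l / a)]) e0.le
  have b2 : (-y s - (-(l / a) + ε / 2)) * Real.exp (-a * (t - s))
      ≤ (|y s - l / a| + ε / 2) * Real.exp (-a * (t - s)) :=
    mul_le_mul_of_nonneg_right (by linarith [neg_abs_le (y s - l / a)]) e0.le
  rw [Real.dist_eq, abs_lt]
  constructor <;> linarith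

/-! ### Elementary inequalities for the logarithm -/

/-- Apply log z ≤ z - 1 at z = 1/√x. Square roots of rapidly decreasing families are again rapidly
decreasing, so this controls entropy terms at the edge of a truncation. -/
lemma neg_mul_log_le_two_mul_sqrt {x : ℝ} (hx : 0 < x) : -(x * Real.log x) ≤ 2 * √x := by
  have hs : 0 < √x := Real.sqrt_pos.2 hx
  have h1 := Real.log_le_sub_one_of_pos (inv_pos.2 hs)
  rw [Real.log_inv, Real.log_sqrt hx.le] at h1
  have h2 : x = √x * √x := (Real.mul_self_sqrt hx.le).symm
  have h3 : x * (√x)⁻¹ = √x := by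
    nth_rewrite 1 [h2]; field_simp
  have h4 := mul_le_mul_of_nonneg_left h1 hx.le
  nlinarith

/-- For y ≤ x, log z ≤ z - 1 at z = y/x gives log x - log y ≥ (x - y)/x ≥ (x - y)/B. It makes the
dissipation across an edge dominate the squared flux. -/
lemma sq_sub_div_le_mul_log_sub_log {x y B : ℝ} (hx : 0 < x) (hy : 0 < y) (hxB : x ≤ B)
    (hyB : y ≤ B) : (x - y) ^ 2 / B ≤ (x - y) * (Real.log x - Real.log y) := by
  wlog hxy : y ≤ x generalizing x y
  · have := this hy hx hyB hxB (le_of_not_ge hxy)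
    calc (x - y) ^ 2 / B = (y - x) ^ 2 / B := by ring
      _ ≤ _ := this
      _ = _ := by ring
  have h1 := Real.log_le_sub_one_of_pos (div_pos hy hx)
  rw [Real.log_div hy.ne' hx.ne'] at h1
  have h2 : (x - y) / x ≤ Real.log x - Real.log y := by
    have : (x - y) / x = 1 - y / x := by field_simp
    linarith
  have h3 : (x - y) / B ≤ (x - y) / x := div_le_div_of_nonneg_left (by linarith) hx hxB
  calc (x - y) ^ 2 / B = (x - y) * ((x - y) / B) := by ring
    _ ≤ _ := mul_le_mul_of_nonneg_left (h3.trans h2) (by linarith)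

lemma mul_log_sub_log_pos {x y : ℝ} (hx : 0 < x) (hy : 0 < y) (hxy : x ≠ y) :
    0 < (x - y) * (Real.log x - Real.log y) := by
  have h := sq_sub_div_le_mul_log_sub_log hx hy (le_max_left x y) (le_max_right x y)
  have h2 : 0 < (x - y) ^ 2 / max x y :=
    div_pos (by have := sub_ne_zero.2 hxy; positivity) (lt_max_of_lt_left hx)
  linarith

lemma mul_log_sub_log_nonneg {x y : ℝ} (hx : 0 < x) (hy : 0 < y) :
    0 ≤ (x - y) * (Real.log x - Real.log y) := by
  by_cases h : x = y
  · simp [h]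
  · exact (mul_log_sub_log_pos hx hy h).le

/-! ### Rapidly decreasing and tempered families of sequences on `ℤ` -/

lemma summable_exp_neg_abs : Summable fun n : ℤ => Real.exp (-|(n : ℝ)|) := by
  rw [summable_int_iff_summable_nat_and_neg]
  simpa using Real.summable_exp_neg_nat

/-- `u t n` decays faster than every exponential in `|n|`, uniformly in `t ∈ s`. -/
def RapidOn (s : Set ℝ) (u : ℝ → ℤ → ℝ) : Prop :=
  ∀ k : ℝ, ∃ K : ℝ, 0 ≤ K ∧ ∀ t ∈ s, ∀ n : ℤ, |u t n| ≤ K * Real.exp (-k * |(n : ℝ)|)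

/-- `u t n` grows at most exponentially in `|n|`, uniformly in `t ∈ s`. -/
def TemperedOn (s : Set ℝ) (u : ℝ → ℤ → ℝ) : Prop :=
  ∃ k K : ℝ, 0 ≤ k ∧ 0 ≤ K ∧ ∀ t ∈ s, ∀ n : ℤ, |u t n| ≤ K * Real.exp (k * |(n : ℝ)|)

section RapidTempered

variable {s : Set ℝ} {u v a b : ℝ → ℤ → ℝ}

lemma RapidOn.of_abs_le (h : RapidOn s u) (hv : ∀ t ∈ s, ∀ n, |v t n| ≤ |u t n|) :
    RapidOn s v := fun k =>
  let ⟨K, hK, hb⟩ := h k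
  ⟨K, hK, fun t ht n => (hv t ht n).trans (hb t ht n)⟩

lemma RapidOn.abs (h : RapidOn s u) : RapidOn s fun t n => |u t n| :=
  h.of_abs_le fun _ _ _ => by simp

lemma RapidOn.neg (h : RapidOn s u) : RapidOn s fun t n => -u t n :=
  h.of_abs_le fun _ _ _ => by simp

lemma RapidOn.add (hu : RapidOn s u) (hv : RapidOn s v) :
    RapidOn s fun t n => u t n + v t n := fun k => by
  obtain ⟨K, hK, hb⟩ := hu k
  obtain ⟨K', hK', hb'⟩ := hv k
  refine ⟨K + K', by positivity, fun t ht n => (abs_add_le _ _).trans ?_⟩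
  rw [add_mul]
  exact add_le_add (hb t ht n) (hb' t ht n)

lemma RapidOn.sub (hu : RapidOn s u) (hv : RapidOn s v) :
    RapidOn s fun t n => u t n - v t n := by
  simpa [sub_eq_add_neg] using hu.add hv.neg

lemma RapidOn.mul_tempered (hu : RapidOn s u) (ha : TemperedOn s a) :
    RapidOn s fun t n => u t n * a t n := fun k => by
  obtain ⟨l, A, -, hA, ha⟩ := ha
  obtain ⟨K, hK, hb⟩ := hu (k + l)
  refine ⟨K * A, by positivity, fun t ht n => ?_⟩
  rw [abs_mul]
  calc |u t n| * |a t n|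
      ≤ (K * Real.exp (-(k + l) * |(n : ℝ)|)) * (A * Real.exp (l * |(n : ℝ)|)) :=
        mul_le_mul (hb t ht n) (ha t ht n) (abs_nonneg _) (by positivity)
    _ = K * A * (Real.exp (-(k + l) * |(n : ℝ)|) * Real.exp (l * |(n : ℝ)|)) := by ring
    _ = _ := by rw [← Real.exp_add]; congr 2; ring

lemma TemperedOn.mul_rapid (ha : TemperedOn s a) (hu : RapidOn s u) :
    RapidOn s fun t n => a t n * u t n := by
  simpa [mul_comm] using hu.mul_tempered ha

lemma abs_intCast_add_le (n d : ℤ) : |((n + d : ℤ) : ℝ)| ≤ |(n : ℝ)| + |(d : ℝ)| := by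
  push_cast; exact abs_add_le _ _

lemma le_abs_intCast_add (n d : ℤ) : |(n : ℝ)| - |(d : ℝ)| ≤ |((n + d : ℤ) : ℝ)| := by
  push_cast
  have := abs_sub_abs_le_abs_sub (n : ℝ) (-(d : ℝ))
  simpa using this

lemma RapidOn.shift (hu : RapidOn s u) (d : ℤ) : RapidOn s fun t n => u t (n + d) := fun k => by
  obtain ⟨K, hK, hb⟩ := hu |k|
  refine ⟨K * Real.exp (|k| * |(d : ℝ)|), by positivity, fun t ht n => (hb t ht _).trans ?_⟩
  rw [mul_assoc, ← Real.exp_add]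
  gcongr
  have h1 := mul_le_mul_of_nonneg_left (le_abs_intCast_add n d) (abs_nonneg k)
  have h2 := mul_le_mul_of_nonneg_right (le_abs_self k) (abs_nonneg (n : ℝ))
  linarith

lemma TemperedOn.mono {s' : Set ℝ} (h : TemperedOn s a) (hs : s' ⊆ s) : TemperedOn s' a :=
  let ⟨k, K, hk, hK, hb⟩ := h
  ⟨k, K, hk, hK, fun t ht => hb t (hs ht)⟩

lemma TemperedOn.mul (ha : TemperedOn s a) (hb : TemperedOn s b) :
    TemperedOn s fun t n => a t n * b t n := by
  obtain ⟨k, K, hk, hK, ha⟩ := ha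
  obtain ⟨l, L, hl, hL, hb⟩ := hb
  refine ⟨k + l, K * L, by positivity, by positivity, fun t ht n => ?_⟩
  rw [abs_mul, add_mul, Real.exp_add]
  calc |a t n| * |b t n| ≤ (K * Real.exp (k * |(n : ℝ)|)) * (L * Real.exp (l * |(n : ℝ)|)) :=
        mul_le_mul (ha t ht n) (hb t ht n) (abs_nonneg _) (by positivity)
    _ = _ := by ring

lemma TemperedOn.add (ha : TemperedOn s a) (hb : TemperedOn s b) :
    TemperedOn s fun t n => a t n + b t n := by
  obtain ⟨k, K, hk, hK, ha⟩ := ha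
  obtain ⟨l, L, hl, hL, hb⟩ := hb
  refine ⟨k + l, K + L, by positivity, by positivity, fun t ht n => (abs_add_le _ _).trans ?_⟩
  have h1 : Real.exp (k * |(n : ℝ)|) ≤ Real.exp ((k + l) * |(n : ℝ)|) := by
    gcongr; linarith
  have h2 : Real.exp (l * |(n : ℝ)|) ≤ Real.exp ((k + l) * |(n : ℝ)|) := by
    gcongr; linarith
  rw [add_mul]
  exact add_le_add ((ha t ht n).trans (by gcongr)) ((hb t ht n).trans (by gcongr))

lemma TemperedOn.neg (ha : TemperedOn s a) : TemperedOn s fun t n => -a t n := by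
  obtain ⟨k, K, hk, hK, ha⟩ := ha
  exact ⟨k, K, hk, hK, fun t ht n => by simpa using ha t ht n⟩

lemma TemperedOn.sub (ha : TemperedOn s a) (hb : TemperedOn s b) :
    TemperedOn s fun t n => a t n - b t n := by
  simpa [sub_eq_add_neg] using ha.add hb.neg

lemma TemperedOn.shift (ha : TemperedOn s a) (d : ℤ) : TemperedOn s fun t n => a t (n + d) := by
  obtain ⟨k, K, hk, hK, ha⟩ := ha
  refine ⟨k, K * Real.exp (k * |(d : ℝ)|), hk, by positivity, fun t ht n => (ha t ht _).trans ?_⟩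
  rw [mul_assoc, ← Real.exp_add]
  gcongr
  have := mul_le_mul_of_nonneg_left (abs_intCast_add_le n d) hk
  linarith

lemma TemperedOn.of_bounded {f : ℝ → ℤ → ℝ} {K : ℝ} (hf : ∀ t ∈ s, ∀ n, |f t n| ≤ K) :
    TemperedOn s f :=
  ⟨0, |K|, le_rfl, abs_nonneg _, fun t ht n => by
    simpa using (hf t ht n).trans (le_abs_self K)⟩

lemma temperedOn_intCast : TemperedOn s fun _ n => (n : ℝ) :=
  ⟨1, 1, zero_le_one, zero_le_one, fun _ _ n => by
    have := Real.add_one_le_exp |(n : ℝ)|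
    simp only [one_mul]; linarith⟩

lemma temperedOn_exp_mul (c : ℝ) : TemperedOn s fun _ n => Real.exp (c * (n : ℝ)) :=
  ⟨|c|, 1, abs_nonneg _, zero_le_one, fun _ _ n => by
    rw [Real.abs_exp, one_mul, ← abs_mul]
    exact Real.exp_le_exp.2 (le_abs_self _)⟩

/-- One majorant for all times is what dominated convergence and termwise differentiation require.
-/
lemma RapidOn.exists_summable_bound (hu : RapidOn s u) :
    ∃ U : ℤ → ℝ, Summable U ∧ ∀ t ∈ s, ∀ n, |u t n| ≤ U n := by
  obtain ⟨K, hK, hb⟩ := hu 1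
  exact ⟨fun n => K * Real.exp (-|(n : ℝ)|), summable_exp_neg_abs.mul_left K,
    fun t ht n => by simpa using hb t ht n⟩

lemma RapidOn.summable (hu : RapidOn s u) {t : ℝ} (ht : t ∈ s) : Summable (u t) := by
  obtain ⟨U, hU, hb⟩ := hu.exists_summable_bound
  exact Summable.of_norm_bounded hU fun n => hb t ht n

lemma RapidOn.exists_abs_tsum_le (hu : RapidOn s u) : ∃ B, ∀ t ∈ s, |∑' n, u t n| ≤ B := by
  obtain ⟨U, hU, hb⟩ := hu.exists_summable_bound
  exact ⟨∑' n, U n, fun t ht =>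
    tsum_of_norm_bounded (f := u t) hU.hasSum (hb t ht)⟩

lemma RapidOn.tendsto_tsum {l : Filter ℝ} (hu : RapidOn s u) (hl : ∀ᶠ t in l, t ∈ s)
    {q : ℤ → ℝ} (hq : ∀ n, Tendsto (fun t => u t n) l (𝓝 (q n))) :
    Tendsto (fun t => ∑' n, u t n) l (𝓝 (∑' n, q n)) := by
  obtain ⟨U, hU, hb⟩ := hu.exists_summable_bound
  exact tendsto_tsum_of_dominated_convergence hU hq (hl.mono fun t ht n => hb t ht n)

end RapidTempered

lemma hasDerivAt_tsum_of_rapidOn {g g' : ℝ → ℤ → ℝ}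
    (hd : ∀ t, 0 < t → ∀ n, HasDerivAt (fun u => g u n) (g' t n) t)
    (hg : ∀ T, RapidOn (Set.Icc 0 T) g) (hg' : ∀ T, RapidOn (Set.Icc 0 T) g')
    {t : ℝ} (ht : 0 < t) : HasDerivAt (fun u => ∑' n, g u n) (∑' n, g' t n) t := by
  obtain ⟨U, hU, hb⟩ := (hg' (t + 1)).exists_summable_bound
  have hmem : t ∈ Set.Ioo 0 (t + 1) := ⟨ht, by linarith⟩
  exact hasDerivAt_tsum_of_isPreconnected (g := fun n u => g u n) (g' := fun n u => g' u n)
    hU isOpen_Ioo isPreconnected_Ioo (fun n y hy => hd y hy.1 n)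
    (fun n y hy => hb y (Set.Ioo_subset_Icc_self hy) n) hmem
    ((hg (t + 1)).summable (Set.Ioo_subset_Icc_self hmem)) hmem

lemma continuousOn_tsum_of_rapidOn {g : ℝ → ℤ → ℝ}
    (hc : ∀ n, ContinuousOn (fun u => g u n) (Set.Ici 0)) (hg : ∀ T, RapidOn (Set.Icc 0 T) g)
    (T : ℝ) : ContinuousOn (fun u => ∑' n, g u n) (Set.Icc 0 T) := by
  obtain ⟨U, hU, hb⟩ := (hg T).exists_summable_bound
  exact continuousOn_tsum (fun n => (hc n).mono Set.Icc_subset_Ici_self) hU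
    (fun n u hu => hb u hu n)

/-! ### Shifts of sums over `ℤ` -/

lemma tsum_int_shift (f : ℤ → ℝ) (d : ℤ) : ∑' n, f (n + d) = ∑' n, f n :=
  (Equiv.addRight d).tsum_eq f

lemma summable_int_shift {f : ℤ → ℝ} (hf : Summable f) (d : ℤ) : Summable fun n => f (n + d) :=
  (Equiv.addRight d).summable_iff.2 hf

/-- Summation by parts on `ℤ`. -/
lemma tsum_mul_sub_shift {a J : ℤ → ℝ} (h₀ : Summable fun n => a n * J n)
    (h₁ : Summable fun n => a (n + 1) * J n) :
    ∑' n, a n * (J (n - 1) - J n) = ∑' n, J n * (a (n + 1) - a n) := by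
  have h2 : Summable fun n => a n * J (n - 1) := by
    have := summable_int_shift h₁ (-1)
    simpa [sub_eq_add_neg] using this
  have h3 : ∑' n, a n * J (n - 1) = ∑' n, a (n + 1) * J n := by
    rw [← tsum_int_shift (fun n => a n * J (n - 1)) 1]
    simp
  calc ∑' n, a n * (J (n - 1) - J n) = ∑' n, (a n * J (n - 1) - a n * J n) := by
        simp only [mul_sub]
    _ = ∑' n, (a (n + 1) * J n - a n * J n) := by
        rw [h2.tsum_sub h₀, h3, h₁.tsum_sub h₀]
    _ = _ := by congr 1; ext n; ring

/-! ### The weighted norm -/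

/-- Complete the square in |n|; the constant is the maximum of exp((k - α)y - cy²/2) over real y. -/
lemma exists_exp_le_mul_weightB {c : ℝ} (hc : 0 < c) (α k : ℝ) :
    ∃ K : ℝ, 0 ≤ K ∧ ∀ n : ℤ, Real.exp (k * |(n : ℝ)|) ≤ K * weightB c α n := by
  refine ⟨Real.exp ((k - α) ^ 2 / (2 * c)), (Real.exp_pos _).le, fun n => ?_⟩
  rw [weightB, ← Real.exp_add, ← sq_abs (n : ℝ)]
  apply Real.exp_le_exp.2
  have h : 0 ≤ (c * |(n : ℝ)| - (k - α)) ^ 2 / (2 * c) := by positivity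
  have h2 : (c * |(n : ℝ)| - (k - α)) ^ 2 / (2 * c)
      = c * |(n : ℝ)| ^ 2 / 2 - (k - α) * |(n : ℝ)| + (k - α) ^ 2 / (2 * c) := by
    field_simp; ring
  linarith

lemma weightB_pos (c α : ℝ) (n : ℤ) : 0 < weightB c α n := Real.exp_pos _

lemma rapidOn_of_mul_weightB_le {c α B : ℝ} (hc : 0 < c) {s : Set ℝ} {u : ℝ → ℤ → ℝ}
    (hB : ∀ t ∈ s, ∀ n, |u t n| * weightB c α n ≤ B) : RapidOn s u := by
  intro k
  obtain ⟨K, hK, hw⟩ := exists_exp_le_mul_weightB hc α k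
  refine ⟨|B| * K, by positivity, fun t ht n => ?_⟩
  have h1 : 1 ≤ K * weightB c α n * Real.exp (-k * |(n : ℝ)|) := by
    have := mul_le_mul_of_nonneg_right (hw n) (Real.exp_pos (-k * |(n : ℝ)|)).le
    rwa [← Real.exp_add, neg_mul, add_neg_cancel, Real.exp_zero, ← neg_mul] at this
  calc |u t n| ≤ |u t n| * (K * weightB c α n * Real.exp (-k * |(n : ℝ)|)) :=
        le_mul_of_one_le_right (abs_nonneg _) h1
    _ = (|u t n| * weightB c α n) * (K * Real.exp (-k * |(n : ℝ)|)) := by ring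
    _ ≤ |B| * (K * Real.exp (-k * |(n : ℝ)|)) := by
        gcongr; exact (hB t ht n).trans (le_abs_self B)
    _ = _ := by ring

lemma normB_nonneg (c α : ℝ) (q : ℤ → ℝ) : 0 ≤ normB c α q :=
  tsum_nonneg fun n => mul_nonneg (abs_nonneg _) (weightB_pos c α n).le

lemma MemB.mul_weightB_le {c α : ℝ} {q : ℤ → ℝ} (hq : MemB c α q) (n : ℤ) :
    |q n| * weightB c α n ≤ normB c α q :=
  hq.le_tsum n fun m _ => mul_nonneg (abs_nonneg _) (weightB_pos c α m).le

lemma MemB.sub {c α : ℝ} {q r : ℤ → ℝ} (hq : MemB c α q) (hr : MemB c α r) :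
    MemB c α (q - r) := by
  refine Summable.of_nonneg_of_le (fun n => mul_nonneg (abs_nonneg _) (weightB_pos c α n).le)
    (fun n => ?_) (Summable.add hq hr)
  rw [← add_mul]
  exact mul_le_mul_of_nonneg_right (abs_sub _ _) (weightB_pos c α n).le

lemma normB_le_add_normB_sub {c α : ℝ} {q r : ℤ → ℝ} (hq : MemB c α q) (hr : MemB c α r) :
    normB c α q ≤ normB c α r + normB c α (q - r) := by
  have hs := hq.sub hr
  rw [normB, normB, normB, ← Summable.tsum_add hr hs]
  refine Summable.tsum_le_tsum (fun n => ?_) hq (Summable.add hr hs)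
  rw [← add_mul]
  refine mul_le_mul_of_nonneg_right ?_ (weightB_pos c α n).le
  have := abs_add_le (r n) (q n - r n)
  simpa using this

lemma normB_sub_comm (c α : ℝ) (q r : ℤ → ℝ) : normB c α (q - r) = normB c α (r - q) := by
  simp only [normB, Pi.sub_apply, abs_sub_comm]

lemma abs_normB_sub_normB_le {c α : ℝ} {q r : ℤ → ℝ} (hq : MemB c α q) (hr : MemB c α r) :
    |normB c α q - normB c α r| ≤ normB c α (q - r) := by
  have h1 := normB_le_add_normB_sub hq hr
  have h2 := normB_le_add_normB_sub hr hq
  rw [normB_sub_comm c α r q] at h2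
  rw [abs_le]; constructor <;> linarith

/-! ### Fluxes -/

/-- The net probability flux from `n` to `n + 1`. -/
def flux (c : ℝ) (β : ℤ → ℝ) (x : WalkState) (n : ℤ) : ℝ :=
  rateUp c β x.L n * x.p n - rateDown c β x.M (n + 1) * x.p (n + 1)

lemma fieldP_eq_flux_sub (c : ℝ) (β : ℤ → ℝ) (x : WalkState) (n : ℤ) :
    fieldP c β x n = flux c β x (n - 1) - flux c β x n := by
  simp only [fieldP, flux, sub_add_cancel]; ring

/-- Splits off the scalar through which L enters, leaving a fixed sequence of exponential growth.
Mean rates become a scalar times a moment of p. -/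
lemma rateUp_eq (c : ℝ) (β : ℤ → ℝ) (L : ℝ) (n : ℤ) :
    rateUp c β L n = β n * Real.exp (c * L) * Real.exp (-c * (n : ℝ)) := by
  rw [rateUp, mul_assoc, ← Real.exp_add]; congr 2; ring

lemma rateDown_eq (c : ℝ) (β : ℤ → ℝ) (M : ℝ) (n : ℤ) :
    rateDown c β M n = β (n - 1) * Real.exp (-(c * M)) * Real.exp (c * (n : ℝ)) := by
  rw [rateDown, mul_assoc, ← Real.exp_add]; congr 2; ring

section Families

variable {c : ℝ} {β : ℤ → ℝ} {s : Set ℝ} {b₁ R : ℝ}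

lemma temperedOn_rateUp {L : ℝ → ℝ} (hβ : ∀ n, |β n| ≤ b₁) (hL : ∀ t ∈ s, |L t| ≤ R) :
    TemperedOn s fun t n => rateUp c β (L t) n := by
  simp only [rateUp_eq]
  refine TemperedOn.mul (TemperedOn.of_bounded (K := b₁ * Real.exp (|c| * R)) fun t ht n => ?_)
    (temperedOn_exp_mul _)
  rw [abs_mul, Real.abs_exp]
  have h1 : c * L t ≤ |c| * R := (le_abs_self _).trans (by
    rw [abs_mul]; exact mul_le_mul_of_nonneg_left (hL t ht) (abs_nonneg c))
  exact mul_le_mul (hβ n) (Real.exp_le_exp.2 h1) (Real.exp_pos _).le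
    ((abs_nonneg _).trans (hβ n))

lemma temperedOn_rateDown {M : ℝ → ℝ} (hβ : ∀ n, |β n| ≤ b₁) (hM : ∀ t ∈ s, |M t| ≤ R) :
    TemperedOn s fun t n => rateDown c β (M t) n := by
  simp only [rateDown_eq]
  refine TemperedOn.mul (TemperedOn.of_bounded (K := b₁ * Real.exp (|c| * R)) fun t ht n => ?_)
    (temperedOn_exp_mul _)
  rw [abs_mul, Real.abs_exp]
  have h1 : -(c * M t) ≤ |c| * R := (neg_le_abs _).trans (by
    rw [abs_mul]; exact mul_le_mul_of_nonneg_left (hM t ht) (abs_nonneg c))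
  exact mul_le_mul (hβ _) (Real.exp_le_exp.2 h1) (Real.exp_pos _).le
    ((abs_nonneg _).trans (hβ (n - 1)))

lemma rapidOn_flux {Y : ℝ → WalkState} (hβ : ∀ n, |β n| ≤ b₁)
    (hL : ∀ t ∈ s, |(Y t).L| ≤ R) (hM : ∀ t ∈ s, |(Y t).M| ≤ R)
    (hp : RapidOn s fun t => (Y t).p) : RapidOn s fun t => flux c β (Y t) :=
  ((temperedOn_rateUp hβ hL).mul_rapid hp).sub
    (((temperedOn_rateDown hβ hM).mul_rapid hp).shift 1)

end Families

/-! ### Regularity of solutions on compact time intervals -/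

section Solution

variable {c α : ℝ} {β : ℤ → ℝ} {Clam Cmu : ℝ} {X : ℝ → WalkState} {b₁ : ℝ}

lemma IsSolution.continuousOn_normB (hX : IsSolution c α β Clam Cmu X) :
    ContinuousOn (fun t => normB c α (X t).p) (Set.Ici 0) := by
  intro t ht
  rw [ContinuousWithinAt, tendsto_iff_dist_tendsto_zero]
  refine squeeze_zero' (Eventually.of_forall fun _ => dist_nonneg) ?_ (hX.continuous t ht)
  filter_upwards [self_mem_nhdsWithin] with u hu
  exact abs_normB_sub_normB_le (hX.memB u hu) (hX.memB t ht)

lemma IsSolution.continuousOn_L (hX : IsSolution c α β Clam Cmu X) :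
    ContinuousOn (fun t => (X t).L) (Set.Ici 0) := fun t ht =>
  (hX.deriv_L t ht).continuousWithinAt

lemma IsSolution.continuousOn_M (hX : IsSolution c α β Clam Cmu X) :
    ContinuousOn (fun t => (X t).M) (Set.Ici 0) := fun t ht =>
  (hX.deriv_M t ht).continuousWithinAt

lemma IsSolution.continuousOn_p (hX : IsSolution c α β Clam Cmu X) (n : ℤ) :
    ContinuousOn (fun t => (X t).p n) (Set.Ici 0) := fun t ht =>
  (hX.deriv_p t ht n).continuousWithinAt

lemma IsSolution.hasDerivAt_L (hX : IsSolution c α β Clam Cmu X) {t : ℝ} (ht : 0 < t) :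
    HasDerivAt (fun t => (X t).L) (fieldL c β Clam (X t)) t :=
  (hX.deriv_L t ht.le).hasDerivAt (Ici_mem_nhds ht)

lemma IsSolution.hasDerivAt_M (hX : IsSolution c α β Clam Cmu X) {t : ℝ} (ht : 0 < t) :
    HasDerivAt (fun t => (X t).M) (fieldM c β Cmu (X t)) t :=
  (hX.deriv_M t ht.le).hasDerivAt (Ici_mem_nhds ht)

lemma IsSolution.hasDerivAt_p (hX : IsSolution c α β Clam Cmu X) {t : ℝ} (ht : 0 < t) (n : ℤ) :
    HasDerivAt (fun t => (X t).p n) (flux c β (X t) (n - 1) - flux c β (X t) n) t := by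
  rw [← fieldP_eq_flux_sub]
  exact (hX.deriv_p t ht.le n).hasDerivAt (Ici_mem_nhds ht)

/-- The norm is continuous in time, hence bounded on [0, T], and the Gaussian weight beats every
exponential. -/
lemma IsSolution.rapidOn_p (hX : IsSolution c α β Clam Cmu X) (hc : 0 < c) (T : ℝ) :
    RapidOn (Set.Icc 0 T) fun t => (X t).p := by
  obtain ⟨B, hB⟩ := isCompact_Icc.exists_bound_of_continuousOn
    (hX.continuousOn_normB.mono (fun u hu => hu.1 : Set.Icc 0 T ⊆ Set.Ici 0))
  exact rapidOn_of_mul_weightB_le hc fun t ht n =>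
    ((hX.memB t ht.1).mul_weightB_le n).trans ((le_abs_self _).trans (hB t ht))

lemma IsSolution.exists_abs_le (hX : IsSolution c α β Clam Cmu X) (T : ℝ) :
    ∃ R, ∀ t ∈ Set.Icc 0 T, |(X t).L| ≤ R ∧ |(X t).M| ≤ R := by
  obtain ⟨R, hR⟩ := isCompact_Icc.exists_bound_of_continuousOn
    (hX.continuousOn_L.mono (fun u hu => hu.1 : Set.Icc 0 T ⊆ Set.Ici 0))
  obtain ⟨R', hR'⟩ := isCompact_Icc.exists_bound_of_continuousOn
    (hX.continuousOn_M.mono (fun u hu => hu.1 : Set.Icc 0 T ⊆ Set.Ici 0))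
  exact ⟨max R R', fun t ht => ⟨(hR t ht).trans (le_max_left _ _),
    (hR' t ht).trans (le_max_right _ _)⟩⟩

lemma IsSolution.rapidOn_flux (hX : IsSolution c α β Clam Cmu X) (hc : 0 < c)
    (hβ : ∀ n, |β n| ≤ b₁) (T : ℝ) : RapidOn (Set.Icc 0 T) fun t => flux c β (X t) := by
  obtain ⟨R, hR⟩ := hX.exists_abs_le T
  exact _root_.rapidOn_flux hβ (fun t ht => (hR t ht).1) (fun t ht => (hR t ht).2)
    (hX.rapidOn_p hc T)

lemma IsSolution.continuousOn_moment (hX : IsSolution c α β Clam Cmu X) (hc : 0 < c)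
    {a : ℤ → ℝ} (ha : TemperedOn Set.univ fun _ => a) (T : ℝ) :
    ContinuousOn (fun t => ∑' n, a n * (X t).p n) (Set.Icc 0 T) :=
  continuousOn_tsum_of_rapidOn (fun n => continuousOn_const.mul (hX.continuousOn_p n))
    (fun T => (ha.mono (Set.subset_univ _)).mul_rapid (hX.rapidOn_p hc T)) T

/-- Differentiate termwise, then sum by parts to move the difference from the flux onto the test
sequence. Both steps are legitimate because p and the flux decay rapidly, uniformly on compact time
intervals. -/
lemma IsSolution.hasDerivAt_moment (hX : IsSolution c α β Clam Cmu X) (hc : 0 < c)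
    (hβ : ∀ n, |β n| ≤ b₁) {a : ℤ → ℝ} (ha : TemperedOn Set.univ fun _ => a) {t : ℝ}
    (ht : 0 < t) : HasDerivAt (fun t => ∑' n, a n * (X t).p n)
      (∑' n, flux c β (X t) n * (a (n + 1) - a n)) t := by
  have ha' : ∀ T, TemperedOn (Set.Icc 0 T) fun _ => a := fun T => ha.mono (Set.subset_univ _)
  have hJ := fun T => hX.rapidOn_flux hc hβ T
  have hJ' : ∀ T, RapidOn (Set.Icc 0 T) fun t n => flux c β (X t) (n - 1) := fun T =>
    (hJ T).shift (-1)
  have hmem : t ∈ Set.Icc 0 t := ⟨ht.le, le_rfl⟩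
  rw [← tsum_mul_sub_shift (((ha' t).mul_rapid (hJ t)).summable hmem)
    ((((ha' t).shift 1).mul_rapid (hJ t)).summable hmem)]
  exact hasDerivAt_tsum_of_rapidOn (fun t ht n => (hX.hasDerivAt_p ht n).const_mul (a n))
    (fun T => (ha' T).mul_rapid (hX.rapidOn_p hc T))
    (fun T => (ha' T).mul_rapid ((hJ' T).sub (hJ T))) ht

lemma temperedOn_const {s : Set ℝ} (r : ℝ) : TemperedOn s fun _ _ => r :=
  TemperedOn.of_bounded (K := |r|) fun _ _ _ => le_rfl

/-- Total mass is conserved. -/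
lemma IsSolution.tsum_p_eq (hX : IsSolution c α β Clam Cmu X) (hc : 0 < c)
    (hβ : ∀ n, |β n| ≤ b₁) {t : ℝ} (ht : 0 ≤ t) : ∑' n, (X t).p n = ∑' n, (X 0).p n := by
  have h := eq_of_hasDerivAt_zero ht
    (hX.continuousOn_moment hc (a := fun _ => 1) (temperedOn_const 1) t)
    (fun u hu => by
      simpa using hX.hasDerivAt_moment hc hβ (a := fun _ => 1) (temperedOn_const 1) hu.1)
  simpa using h

/-! ### Positivity -/

/-- The `ℓ¹` norm does not increase along solutions. -/
lemma IsSolution.tsum_abs_p_le (hX : IsSolution c α β Clam Cmu X) (hc : 0 < c)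
    (hβ : ∀ n, |β n| ≤ b₁) (hβ₀ : ∀ n, 0 ≤ β n) {T : ℝ} (hT : 0 ≤ T) :
    ∑' n, |(X T).p n| ≤ ∑' n, |(X 0).p n| := by
  -- A summable positive profile, decaying fast enough to stay summable against the rates.
  set ρ : ℤ → ℝ := fun n => (weightB c 0 n)⁻¹
  have hρ0 : ∀ n, 0 < ρ n := fun n => inv_pos.2 (weightB_pos c 0 n)
  have hρ : ∀ s : Set ℝ, RapidOn s fun _ => ρ := fun s =>
    rapidOn_of_mul_weightB_le (α := 0) (B := 1) hc fun t _ n => by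
      rw [abs_of_pos (hρ0 n)]; exact (inv_mul_cancel₀ (weightB_pos c 0 n).ne').le
  obtain ⟨R, hR⟩ := hX.exists_abs_le T
  have hup : TemperedOn (Set.Icc 0 T) fun t n => rateUp c β (X t).L n :=
    temperedOn_rateUp hβ (fun t ht => (hR t ht).1)
  have hdn : TemperedOn (Set.Icc 0 T) fun t n => rateDown c β (X t).M n :=
    temperedOn_rateDown hβ (fun t ht => (hR t ht).2)
  have hrate := (hup.add hdn).mul_rapid (hρ _)
  obtain ⟨B, hB⟩ := hrate.exists_abs_tsum_le
  have hp := fun T => hX.rapidOn_p hc T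
  have habs : RapidOn (Set.Icc 0 T) fun t => flux c β ⟨(X t).L, (X t).M, fun n => |(X t).p n|⟩ :=
    _root_.rapidOn_flux hβ (fun t ht => (hR t ht).1) (fun t ht => (hR t ht).2) (hp T).abs
  have hmem0 : (0 : ℝ) ∈ Set.Icc 0 T := ⟨le_rfl, hT⟩
  have hmemT : T ∈ Set.Icc 0 T := ⟨hT, le_rfl⟩
  have key : ∀ ε, 0 < ε → ∑' n, |(X T).p n| ≤ ∑' n, |(X 0).p n| + ε * (∑' n, ρ n + B * T) := by
    intro ε hε
    -- Smooth regularization of |p n|; the cutoff depends on n so that the sum over n stays finite.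
    set g : ℝ → ℤ → ℝ := fun t n => √((X t).p n ^ 2 + (ε * ρ n) ^ 2)
    set g' : ℝ → ℤ → ℝ := fun t n =>
      (X t).p n / g t n * (flux c β (X t) (n - 1) - flux c β (X t) n)
    have hε0 : ∀ n, 0 < ε * ρ n := fun n => mul_pos hε (hρ0 n)
    have hpos : ∀ t n, 0 < (X t).p n ^ 2 + (ε * ρ n) ^ 2 := fun t n => by
      have := hε0 n; positivity
    have hgpos : ∀ t n, 0 < g t n := fun t n => Real.sqrt_pos.2 (hpos t n)
    have hgge : ∀ t n, |(X t).p n| ≤ g t n := fun t n =>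
      Real.abs_le_sqrt (le_add_of_nonneg_right (sq_nonneg _))
    have hgge' : ∀ t n, ε * ρ n ≤ g t n := fun t n =>
      Real.le_sqrt_of_sq_le (le_add_of_nonneg_left (sq_nonneg _))
    have hgle : ∀ t n, g t n ≤ |(X t).p n| + ε * ρ n := fun t n => by
      refine Real.sqrt_le_iff.2 ⟨by have := (hε0 n).le; positivity, ?_⟩
      have h1 := sq_abs ((X t).p n)
      have h2 := mul_nonneg (abs_nonneg ((X t).p n)) (hε0 n).le
      nlinarith
    have hgsq : ∀ t n, g t n * g t n = (X t).p n ^ 2 + (ε * ρ n) ^ 2 := fun t n =>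
      Real.mul_self_sqrt (hpos t n).le
    have hquot : ∀ t n, |(X t).p n / g t n| ≤ 1 := fun t n => by
      rw [abs_div, abs_of_pos (hgpos t n)]
      exact (div_le_one (hgpos t n)).2 (hgge t n)
    have hd : ∀ t, 0 < t → ∀ n, HasDerivAt (fun u => g u n) (g' t n) t := by
      intro t ht n
      have h1 := (((hX.hasDerivAt_p ht n).pow 2).add_const ((ε * ρ n) ^ 2)).sqrt (hpos t n).ne'
      refine h1.congr_deriv ?_
      have := (hgpos t n).ne'
      simp only [g', g] at this ⊢
      field_simp
      simp
      ring
    have hερ : ∀ s : Set ℝ, RapidOn s fun _ n => ε * ρ n := fun s =>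
      (temperedOn_const ε).mul_rapid (hρ s)
    have hg : ∀ T, RapidOn (Set.Icc 0 T) g := fun T =>
      ((hp T).abs.add (hερ _)).of_abs_le fun t _ n => by
        rw [abs_of_pos (hgpos t n)]
        exact (hgle t n).trans (le_abs_self _)
    have hJ := fun T => hX.rapidOn_flux hc hβ T
    have hg' : ∀ T, RapidOn (Set.Icc 0 T) g' := fun T =>
      (((hJ T).shift (-1)).sub (hJ T)).of_abs_le fun t _ n => by
        rw [abs_mul]
        exact mul_le_of_le_one_left (abs_nonneg _) (hquot t n)
    have hcont := continuousOn_tsum_of_rapidOn (g := g) (fun n =>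
      (((hX.continuousOn_p n).pow 2).add continuousOn_const).sqrt) hg T
    have hbound : ∀ t ∈ Set.Ioo 0 T, ∑' n, g' t n ≤ ε * B := by
      intro t ht
      have htm := Set.Ioo_subset_Icc_self ht
      -- Comparison flux of |p|, with the same L and M; its differences sum to zero.
      set J := flux c β ⟨(X t).L, (X t).M, fun n => |(X t).p n|⟩
      have hJs : Summable J := habs.summable htm
      have hJs' : Summable fun n => J (n - 1) := summable_int_shift hJs (-1)
      have hzero : ∑' n, (J (n - 1) - J n) = 0 := by
        rw [hJs'.tsum_sub hJs, sub_eq_zero]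
        exact tsum_int_shift J (-1)
      have hr := hrate.summable htm
      -- Kato's inequality: inflow from neighbours only grows when p is replaced by |p|, because
      -- |p/g| ≤ 1. In the outflow, p²/g falls short of |p| by at most ερ.
      have hpt : ∀ n, g' t n ≤ (J (n - 1) - J n)
          + ε * ((rateUp c β (X t).L n + rateDown c β (X t).M n) * ρ n) := by
        intro n
        have hrU : ∀ m, 0 ≤ rateUp c β (X t).L m := fun m =>
          mul_nonneg (hβ₀ _) (Real.exp_pos _).le
        have hrD : ∀ m, 0 ≤ rateDown c β (X t).M m := fun m =>
          mul_nonneg (hβ₀ _) (Real.exp_pos _).le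
        have hσ : ∀ x, (X t).p n / g t n * x ≤ |x| := fun x => by
          refine (le_abs_self _).trans ?_
          rw [abs_mul]
          exact mul_le_of_le_one_left (abs_nonneg _) (hquot t n)
        have hσp : |(X t).p n| - ε * ρ n ≤ (X t).p n / g t n * (X t).p n := by
          have h0 := hgpos t n
          have : (X t).p n / g t n * (X t).p n = g t n - ε * ρ n * (ε * ρ n / g t n) := by
            field_simp
            linarith [hgsq t n]
          rw [this]
          have h3 : ε * ρ n / g t n ≤ 1 := (div_le_one h0).2 (hgge' t n)
          have h4 := mul_le_of_le_one_right (hε0 n).le h3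
          linarith [hgge t n]
        have e1 := mul_le_mul_of_nonneg_left (hσ ((X t).p (n - 1))) (hrU (n - 1))
        have e2 := mul_le_mul_of_nonneg_left (hσ ((X t).p (n + 1))) (hrD (n + 1))
        have e3 := mul_le_mul_of_nonneg_left hσp (add_nonneg (hrU n) (hrD n))
        simp only [g', J, flux, sub_add_cancel]
        linear_combination e1 + e2 + e3
      calc ∑' n, g' t n ≤ ∑' n, ((J (n - 1) - J n)
            + ε * ((rateUp c β (X t).L n + rateDown c β (X t).M n) * ρ n)) :=
            Summable.tsum_le_tsum hpt ((hg' T).summable htm)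
              ((hJs'.sub hJs).add (hr.mul_left ε))
        _ = ε * ∑' n, (rateUp c β (X t).L n + rateDown c β (X t).M n) * ρ n := by
            rw [(hJs'.sub hJs).tsum_add (hr.mul_left ε), hzero, zero_add, tsum_mul_left]
        _ ≤ ε * B := mul_le_mul_of_nonneg_left ((le_abs_self _).trans (hB t htm)) hε.le
    have hinc := sub_le_of_hasDerivAt_le hT hcont
      (fun t ht => hasDerivAt_tsum_of_rapidOn hd hg hg' ht.1) hbound
    have hpa : ∀ t ∈ Set.Icc 0 T, Summable fun n => |(X t).p n| := fun t ht =>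
      (hp T).abs.summable ht
    have hρs : Summable ρ := (hρ Set.univ).summable (Set.mem_univ (0 : ℝ))
    have h1 : ∑' n, |(X T).p n| ≤ ∑' n, g T n :=
      Summable.tsum_le_tsum (hgge T) (hpa T hmemT) ((hg T).summable hmemT)
    have h2 : ∑' n, g 0 n ≤ ∑' n, |(X 0).p n| + ε * ∑' n, ρ n := by
      rw [← tsum_mul_left, ← (hpa 0 hmem0).tsum_add (hρs.mul_left ε)]
      exact Summable.tsum_le_tsum (hgle 0) ((hg T).summable hmem0)
        ((hpa 0 hmem0).add (hρs.mul_left ε))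
    rw [sub_zero] at hinc
    linarith
  refine le_of_forall_pos_le_add fun δ hδ => ?_
  set Q := ∑' n, ρ n + B * T
  refine (key (δ / (|Q| + 1)) (by positivity)).trans (add_le_add le_rfl ?_)
  rw [div_mul_eq_mul_div, div_le_iff₀ (by positivity)]
  exact mul_le_mul_of_nonneg_left (by linarith [le_abs_self Q]) hδ.le

/-- Total mass 1 and ℓ¹ norm at most 1 make the nonnegative terms |p n| - p n sum to at most zero.
-/
lemma IsSolution.isProbVec (hX : IsSolution c α β Clam Cmu X) (hc : 0 < c)
    (hβ : ∀ n, |β n| ≤ b₁) (hβ₀ : ∀ n, 0 ≤ β n) (h0 : IsProbVec (X 0).p) {t : ℝ} (ht : 0 ≤ t) :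
    IsProbVec (X t).p := by
  have hs : Summable (X t).p := (hX.rapidOn_p hc t).summable ⟨ht, le_rfl⟩
  have h1 : ∑' n, (X t).p n = 1 := (hX.tsum_p_eq hc hβ ht).trans h0.2.tsum_eq
  have h2 : ∑' n, |(X t).p n| ≤ 1 := by
    refine (hX.tsum_abs_p_le hc hβ hβ₀ ht).trans ?_
    simp only [abs_of_nonneg (h0.1 _), h0.2.tsum_eq, le_refl]
  refine ⟨fun n => ?_, h1 ▸ hs.hasSum⟩
  by_contra! hn
  have h3 : ∑' n, (|(X t).p n| - (X t).p n) ≤ 0 := by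
    rw [hs.abs.tsum_sub hs]; linarith
  have h4 : |(X t).p n| - (X t).p n ≤ ∑' n, (|(X t).p n| - (X t).p n) :=
    (hs.abs.sub hs).le_tsum n fun m _ => sub_nonneg.2 (le_abs_self _)
  have h5 := abs_nonneg ((X t).p n)
  linarith

end Solution

/-! ### Mean rates -/

lemma RapidOn.const_of_mem {s : Set ℝ} {u : ℝ → ℤ → ℝ} (h : RapidOn s u) {t : ℝ} (ht : t ∈ s) :
    RapidOn Set.univ fun _ => u t := fun k =>
  let ⟨K, hK, hb⟩ := h k
  ⟨K, hK, fun _ _ => hb t ht⟩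

/-- The mean upward jump rate. -/
def meanUp (c : ℝ) (β : ℤ → ℝ) (x : WalkState) : ℝ := ∑' n : ℤ, x.p n * rateUp c β x.L n

/-- The mean downward jump rate. -/
def meanDown (c : ℝ) (β : ℤ → ℝ) (x : WalkState) : ℝ := ∑' n : ℤ, x.p n * rateDown c β x.M n

/-- The mean position. -/
def meanPos (x : WalkState) : ℝ := ∑' n : ℤ, (n : ℝ) * x.p n

/-- The generator of the walk with frozen rates applied to `a`, averaged over `x.p`. -/
def meanGen (c : ℝ) (β : ℤ → ℝ) (x : WalkState) (a : ℤ → ℝ) : ℝ :=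
  ∑' n : ℤ, x.p n * (rateUp c β x.L n * (a (n + 1) - a n)
    + rateDown c β x.M n * (a (n - 1) - a n))

lemma fieldL_eq (c : ℝ) (β : ℤ → ℝ) (Clam : ℝ) (x : WalkState) :
    fieldL c β Clam x = -meanUp c β x + Clam := rfl

lemma fieldM_eq (c : ℝ) (β : ℤ → ℝ) (Cmu : ℝ) (x : WalkState) :
    fieldM c β Cmu x = meanDown c β x - Cmu := rfl

section Static

variable {c : ℝ} {β : ℤ → ℝ} {x : WalkState} {b₀ b₁ : ℝ}

lemma temperedOn_rateUp_const (hβ : ∀ n, |β n| ≤ b₁) (L : ℝ) :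
    TemperedOn Set.univ fun _ => rateUp c β L :=
  temperedOn_rateUp (L := fun _ => L) hβ fun _ _ => le_rfl

lemma temperedOn_rateDown_const (hβ : ∀ n, |β n| ≤ b₁) (M : ℝ) :
    TemperedOn Set.univ fun _ => rateDown c β M :=
  temperedOn_rateDown (M := fun _ => M) hβ fun _ _ => le_rfl

/-- The exponentials in n cancel, leaving a bound uniform in n. This produces the forcing exp(c(L -
M)) in the inequalities for the mean rates. -/
lemma rateUp_mul_rateDown (c : ℝ) (β : ℤ → ℝ) (L M : ℝ) (n : ℤ) :
    rateDown c β M n * rateUp c β L (n - 1)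
      = β (n - 1) ^ 2 * (Real.exp c * Real.exp (c * (L - M))) := by
  rw [rateUp, rateDown]
  have : Real.exp (c * ((n : ℝ) - M)) * Real.exp (-c * (((n - 1 : ℤ) : ℝ) - L))
      = Real.exp c * Real.exp (c * (L - M)) := by
    rw [← Real.exp_add, ← Real.exp_add]; congr 1; push_cast; ring
  linear_combination β (n - 1) ^ 2 * this

/-- Passes from a sum over edges to a sum over sites by shifting the downward part by one. -/
lemma tsum_flux_mul_sub (hβ : ∀ n, |β n| ≤ b₁) (hp : RapidOn Set.univ fun _ => x.p)
    {a : ℤ → ℝ} (ha : TemperedOn Set.univ fun _ => a) :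
    ∑' n, flux c β x n * (a (n + 1) - a n) = meanGen c β x a := by
  have hU := temperedOn_rateUp_const (c := c) hβ x.L
  have hD := temperedOn_rateDown_const (c := c) hβ x.M
  have ha1 : TemperedOn Set.univ fun _ n => a (n + 1) - a n := (ha.shift 1).sub ha
  have ha2 : TemperedOn Set.univ fun _ n => a (n - 1) - a n := (ha.shift (-1)).sub ha
  have m : (0 : ℝ) ∈ Set.univ := Set.mem_univ _
  have s1 : Summable fun n => x.p n * (rateUp c β x.L n * (a (n + 1) - a n)) :=
    (hp.mul_tempered (hU.mul ha1)).summable m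
  have s2 : Summable fun n => x.p n * (rateDown c β x.M n * (a (n - 1) - a n)) :=
    (hp.mul_tempered (hD.mul ha2)).summable m
  have s3 := summable_int_shift s2 1
  rw [meanGen]
  simp only [mul_add]
  rw [s1.tsum_add s2, ← tsum_int_shift (fun n => x.p n * (rateDown c β x.M n * _)) 1,
    ← s1.tsum_add s3]
  congr 1; ext n
  simp only [flux, add_sub_cancel_right]; ring

lemma summable_p (hp : RapidOn Set.univ fun _ => x.p) {a : ℤ → ℝ}
    (ha : TemperedOn Set.univ fun _ => a) : Summable fun n => x.p n * a n :=
  (hp.mul_tempered ha).summable (Set.mem_univ (0 : ℝ))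

lemma tsum_flux (hβ : ∀ n, |β n| ≤ b₁) (hp : RapidOn Set.univ fun _ => x.p) :
    ∑' n, flux c β x n = meanUp c β x - meanDown c β x := by
  have h := tsum_flux_mul_sub (c := c) hβ hp (a := fun n => (n : ℝ)) temperedOn_intCast
  simp only [Int.cast_add, Int.cast_one, add_sub_cancel_left, mul_one] at h
  rw [h, meanGen, meanUp, meanDown,
    ← (summable_p hp (temperedOn_rateUp_const hβ x.L)).tsum_sub
      (summable_p hp (temperedOn_rateDown_const hβ x.M))]
  congr 1; ext n; push_cast; ring

lemma meanUp_nonneg (hβ₀ : ∀ n, 0 ≤ β n) (hp : ∀ n, 0 ≤ x.p n) : 0 ≤ meanUp c β x :=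
  tsum_nonneg fun n => mul_nonneg (hp n) (mul_nonneg (hβ₀ _) (Real.exp_pos _).le)

lemma meanDown_nonneg (hβ₀ : ∀ n, 0 ≤ β n) (hp : ∀ n, 0 ≤ x.p n) : 0 ≤ meanDown c β x :=
  tsum_nonneg fun n => mul_nonneg (hp n) (mul_nonneg (hβ₀ _) (Real.exp_pos _).le)

lemma hasSum_affine (hprob : IsProbVec x.p) (hp : RapidOn Set.univ fun _ => x.p) (r s : ℝ) :
    HasSum (fun n => x.p n * (r + s * (n : ℝ))) (r + s * meanPos x) := by
  have h1 := hprob.2.mul_left r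
  have h2 : Summable fun n : ℤ => (n : ℝ) * x.p n := by
    simpa [mul_comm] using summable_p hp (a := fun n => (n : ℝ)) temperedOn_intCast
  have h3 := h1.add (h2.hasSum.mul_left s)
  rw [mul_one] at h3
  refine h3.congr_fun ?_
  intro n; ring

/-- Average exp(y) ≥ 1 + y over p. -/
lemma le_meanUp (hb₀ : 0 ≤ b₀) (hβ₀ : ∀ n, b₀ ≤ β n) (hβ : ∀ n, |β n| ≤ b₁)
    (hprob : IsProbVec x.p) (hp : RapidOn Set.univ fun _ => x.p) :
    b₀ * (1 + c * (x.L - meanPos x)) ≤ meanUp c β x := by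
  have h := hasSum_affine hprob hp (b₀ * (1 + c * x.L)) (-(b₀ * c))
  refine le_trans (le_of_eq ?_) (hasSum_le (fun n => ?_) h
    (summable_p hp (temperedOn_rateUp_const hβ x.L)).hasSum)
  · ring
  · refine mul_le_mul_of_nonneg_left ?_ (hprob.1 n)
    have h1 := Real.add_one_le_exp (-c * ((n : ℝ) - x.L))
    have h2 := mul_le_mul_of_nonneg_left h1 hb₀
    have h3 := mul_le_mul_of_nonneg_right (hβ₀ n) (Real.exp_pos (-c * ((n : ℝ) - x.L))).le
    rw [rateUp]; linarith

lemma le_meanDown (hb₀ : 0 ≤ b₀) (hβ₀ : ∀ n, b₀ ≤ β n) (hβ : ∀ n, |β n| ≤ b₁)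
    (hprob : IsProbVec x.p) (hp : RapidOn Set.univ fun _ => x.p) :
    b₀ * (1 + c * (meanPos x - x.M)) ≤ meanDown c β x := by
  have h := hasSum_affine hprob hp (b₀ * (1 - c * x.M)) (b₀ * c)
  refine le_trans (le_of_eq ?_) (hasSum_le (fun n => ?_) h
    (summable_p hp (temperedOn_rateDown_const hβ x.M)).hasSum)
  · ring
  · refine mul_le_mul_of_nonneg_left ?_ (hprob.1 n)
    have h1 := Real.add_one_le_exp (c * ((n : ℝ) - x.M))
    have h2 := mul_le_mul_of_nonneg_left h1 hb₀
    have h3 := mul_le_mul_of_nonneg_right (hβ₀ (n - 1)) (Real.exp_pos (c * ((n : ℝ) - x.M))).le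
    rw [rateDown]; linarith

/-- An observable `a` whose generator is at most `-η a² + r` has mean generator at most
`-η (mean a)² + r`. -/
lemma meanGen_le_of_le {a : ℤ → ℝ} {η r : ℝ} (hη : 0 ≤ η) (hβ : ∀ n, |β n| ≤ b₁)
    (hprob : IsProbVec x.p) (hp : RapidOn Set.univ fun _ => x.p)
    (ha : TemperedOn Set.univ fun _ => a)
    (h : ∀ n, rateUp c β x.L n * (a (n + 1) - a n) + rateDown c β x.M n * (a (n - 1) - a n)
      ≤ -(η * a n ^ 2) + r) :
    meanGen c β x a ≤ -(η * (∑' n, x.p n * a n) ^ 2) + r := by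
  set A := ∑' n, x.p n * a n
  have hA : HasSum (fun n => x.p n * a n) A := (summable_p hp ha).hasSum
  -- Jensen by the tangent at the mean: -ηa² ≤ ηA² - 2ηAa, whose average is -ηA².
  have hb : HasSum (fun n => x.p n * (η * A ^ 2 + r) + -(2 * η * A) * (x.p n * a n))
      (1 * (η * A ^ 2 + r) + -(2 * η * A) * A) :=
    (hprob.2.mul_right _).add (hA.mul_left _)
  have hU := temperedOn_rateUp_const (c := c) hβ x.L
  have hD := temperedOn_rateDown_const (c := c) hβ x.M
  have ha1 : TemperedOn Set.univ fun _ n => a (n - 1) - a n := (ha.shift (-1)).sub ha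
  have ha2 : TemperedOn Set.univ fun _ n => a (n + 1) - a n := (ha.shift 1).sub ha
  have hs : Summable fun n => x.p n * (rateUp c β x.L n * (a (n + 1) - a n)
      + rateDown c β x.M n * (a (n - 1) - a n)) := by
    have h1 := hU.mul ha2
    have h2 := hD.mul ha1
    simpa only [mul_add] using (summable_p hp h1).add (summable_p hp h2)
  refine (hasSum_le (fun n => ?_) hs.hasSum hb).trans (le_of_eq (by ring))
  have h1 := mul_le_mul_of_nonneg_left (h n) (hprob.1 n)
  have h2 := mul_nonneg (mul_nonneg hη (hprob.1 n)) (sq_nonneg (a n - A))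
  refine h1.trans ?_
  linarith

/-- An upward jump multiplies exp(-cn) by exp(-c), so the drift condition bounds the upward part of
the generator by a negative multiple of the squared rate. In the downward part the gain is a product
across one edge, bounded uniformly in n, and the loss has a good sign. -/
lemma meanGen_rateUp_le {C : ℝ} (hb₁ : 0 < b₁) (hβ₀ : ∀ n, 0 ≤ β n) (hβ : ∀ n, |β n| ≤ b₁)
    (hC : 0 ≤ C) (hdr : ∀ n, Real.exp (-c) * β (n + 1) - β n ≤ -C)
    (hprob : IsProbVec x.p) (hp : RapidOn Set.univ fun _ => x.p) :
    meanGen c β x (rateUp c β x.L) ≤ -(C / b₁ * meanUp c β x ^ 2)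
      + b₁ ^ 2 * (Real.exp c * Real.exp (c * (x.L - x.M))) := by
  refine meanGen_le_of_le (by positivity) hβ hprob hp (temperedOn_rateUp_const hβ x.L)
    fun n => ?_
  have hle : ∀ n, β n ≤ b₁ := fun n => (le_abs_self _).trans (hβ n)
  set e := Real.exp (-c * ((n : ℝ) - x.L)) with he
  have he0 : 0 < e := Real.exp_pos _
  have h1 : rateUp c β x.L (n + 1) = Real.exp (-c) * β (n + 1) * e := by
    rw [rateUp, he, mul_comm (Real.exp (-c)), mul_assoc, ← Real.exp_add]
    congr 2; push_cast; ring
  have h2 : rateUp c β x.L n = β n * e := rfl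
  have h3 := rateUp_mul_rateDown c β x.L x.M n
  have h4 : 0 ≤ rateDown c β x.M n * rateUp c β x.L n :=
    mul_nonneg (mul_nonneg (hβ₀ _) (Real.exp_pos _).le) (mul_nonneg (hβ₀ _) (Real.exp_pos _).le)
  have h5 : β (n - 1) ^ 2 * (Real.exp c * Real.exp (c * (x.L - x.M)))
      ≤ b₁ ^ 2 * (Real.exp c * Real.exp (c * (x.L - x.M))) := by
    have := hβ₀ (n - 1); have := hle (n - 1); gcongr
  have h6 : rateUp c β x.L n * (rateUp c β x.L (n + 1) - rateUp c β x.L n)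
      ≤ -(C / b₁ * rateUp c β x.L n ^ 2) := by
    rw [h1, h2]
    have h7 : β n * e * (e * (Real.exp (-c) * β (n + 1) - β n)) ≤ β n * e * (e * -C) :=
      mul_le_mul_of_nonneg_left (mul_le_mul_of_nonneg_left (hdr n) he0.le)
        (mul_nonneg (hβ₀ n) he0.le)
    have h8 : C / b₁ * (β n * e) ^ 2 ≤ β n * e * e * C := by
      have : C / b₁ * (β n * e) ^ 2 = (β n * e * e * C) * (β n / b₁) := by field_simp
      rw [this]
      refine mul_le_of_le_one_right ?_ ((div_le_one hb₁).2 (hle n))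
      have := hβ₀ n; positivity
    linarith
  linarith

/-- Mirror image of `meanGen_rateUp_le`. The downward rate at n carries β(n - 1), so the drift
condition is used at n - 1. -/
lemma meanGen_rateDown_le {C : ℝ} (hb₁ : 0 < b₁) (hβ₀ : ∀ n, 0 ≤ β n) (hβ : ∀ n, |β n| ≤ b₁)
    (hC : 0 ≤ C) (hdr : ∀ n, Real.exp (-c) * β (n - 1) - β n ≤ -C)
    (hprob : IsProbVec x.p) (hp : RapidOn Set.univ fun _ => x.p) :
    meanGen c β x (rateDown c β x.M) ≤ -(C / b₁ * meanDown c β x ^ 2)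
      + b₁ ^ 2 * (Real.exp c * Real.exp (c * (x.L - x.M))) := by
  refine meanGen_le_of_le (by positivity) hβ hprob hp (temperedOn_rateDown_const hβ x.M)
    fun n => ?_
  have hle : ∀ n, β n ≤ b₁ := fun n => (le_abs_self _).trans (hβ n)
  set e := Real.exp (c * ((n : ℝ) - x.M)) with he
  have he0 : 0 < e := Real.exp_pos _
  have h1 : rateDown c β x.M (n - 1) = Real.exp (-c) * β (n - 1 - 1) * e := by
    rw [rateDown, he, mul_comm (Real.exp (-c)), mul_assoc, ← Real.exp_add]
    congr 2; push_cast; ring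
  have h2 : rateDown c β x.M n = β (n - 1) * e := rfl
  have h3 := rateUp_mul_rateDown c β x.L x.M (n + 1)
  rw [add_sub_cancel_right] at h3
  have h4 : 0 ≤ rateUp c β x.L n * rateDown c β x.M n :=
    mul_nonneg (mul_nonneg (hβ₀ _) (Real.exp_pos _).le) (mul_nonneg (hβ₀ _) (Real.exp_pos _).le)
  have h5 : β n ^ 2 * (Real.exp c * Real.exp (c * (x.L - x.M)))
      ≤ b₁ ^ 2 * (Real.exp c * Real.exp (c * (x.L - x.M))) := by
    have := hβ₀ n; have := hle n; gcongr
  have h6 : rateDown c β x.M n * (rateDown c β x.M (n - 1) - rateDown c β x.M n)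
      ≤ -(C / b₁ * rateDown c β x.M n ^ 2) := by
    rw [h1, h2]
    have h7 : β (n - 1) * e * (e * (Real.exp (-c) * β (n - 1 - 1) - β (n - 1)))
        ≤ β (n - 1) * e * (e * -C) :=
      mul_le_mul_of_nonneg_left (mul_le_mul_of_nonneg_left (hdr _) he0.le)
        (mul_nonneg (hβ₀ _) he0.le)
    have h8 : C / b₁ * (β (n - 1) * e) ^ 2 ≤ β (n - 1) * e * e * C := by
      have : C / b₁ * (β (n - 1) * e) ^ 2 = (β (n - 1) * e * e * C) * (β (n - 1) / b₁) := by
        field_simp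
      rw [this]
      refine mul_le_of_le_one_right ?_ ((div_le_one hb₁).2 (hle _))
      have := hβ₀ (n - 1); positivity
    linarith
  linarith

end Static

/-! ### Evolution of the mean rates and a priori bounds on L and M -/

section Dynamic

variable {c α : ℝ} {β : ℤ → ℝ} {Clam Cmu : ℝ} {X : ℝ → WalkState} {b₀ b₁ : ℝ}

lemma IsSolution.rapidOn_p_const (hX : IsSolution c α β Clam Cmu X) (hc : 0 < c) {t : ℝ}
    (ht : 0 ≤ t) : RapidOn Set.univ fun _ => (X t).p :=
  (hX.rapidOn_p hc t).const_of_mem ⟨ht, le_rfl⟩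

/-- All states have positive probability at positive times. -/
lemma IsSolution.p_pos (hX : IsSolution c α β Clam Cmu X) (hβ₀ : ∀ n, 0 < β n)
    (hprob : ∀ t, 0 ≤ t → IsProbVec (X t).p) {t : ℝ} (ht : 0 < t) (n : ℤ) : 0 < (X t).p n := by
  have step : ∀ n, (X t).p n = 0 → (X t).p (n - 1) = 0 ∧ (X t).p (n + 1) = 0 := by
    intro n hn
    -- At an interior minimum with value zero the derivative vanishes, and it reduces to the inflow
    -- from the two neighbours.
    have hmin : IsLocalMin (fun u => (X u).p n) t := by
      filter_upwards [Ioi_mem_nhds ht] with u hu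
      rw [hn]; exact (hprob u (le_of_lt hu)).1 n
    have h := hmin.hasDerivAt_eq_zero (hX.hasDerivAt_p ht n)
    simp only [flux, sub_add_cancel, hn, mul_zero, sub_zero, zero_sub, sub_neg_eq_add] at h
    have hU : 0 < rateUp c β (X t).L (n - 1) := mul_pos (hβ₀ _) (Real.exp_pos _)
    have hD : 0 < rateDown c β (X t).M (n + 1) := mul_pos (hβ₀ _) (Real.exp_pos _)
    have h1 := mul_nonneg hU.le ((hprob t ht.le).1 (n - 1))
    have h2 := mul_nonneg hD.le ((hprob t ht.le).1 (n + 1))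
    have h3 := (add_eq_zero_iff_of_nonneg h1 h2).1 h
    exact ⟨(mul_eq_zero.1 h3.1).resolve_left hU.ne', (mul_eq_zero.1 h3.2).resolve_left hD.ne'⟩
  refine lt_of_le_of_ne ((hprob t ht.le).1 n) fun hn => ?_
  have hall : ∀ m, (X t).p m = 0 := fun m => by
    induction m using Int.inductionOn' (b := n) with
    | zero => exact hn.symm
    | succ k _ ih => exact (step k ih).2
    | pred k _ ih => exact (step k ih).1
  have := (hprob t ht.le).2
  simp only [funext hall] at this
  exact zero_ne_one (hasSum_zero.unique this)

lemma IsSolution.hasDerivAt_meanPos (hX : IsSolution c α β Clam Cmu X) (hc : 0 < c)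
    (hβ : ∀ n, |β n| ≤ b₁) {t : ℝ} (ht : 0 < t) :
    HasDerivAt (fun t => meanPos (X t)) (meanUp c β (X t) - meanDown c β (X t)) t := by
  rw [← tsum_flux hβ (hX.rapidOn_p_const hc ht.le)]
  exact (hX.hasDerivAt_moment hc hβ (a := fun n => (n : ℝ)) temperedOn_intCast ht).congr_deriv
    (by simp)

/-- The mean position moves at mean up-rate minus mean down-rate, which L + M undoes exactly when
the two constants agree. -/
lemma IsSolution.conservedK_eq (hX : IsSolution c α β Clam Cmu X) (hc : 0 < c)
    (hβ : ∀ n, |β n| ≤ b₁) (heq : Clam = Cmu) {t : ℝ} (ht : 0 ≤ t) :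
    conservedK (X t) = conservedK (X 0) := by
  refine eq_of_hasDerivAt_zero (f := fun t => conservedK (X t)) ht ?_ fun u hu => ?_
  · exact ((hX.continuousOn_L.mono fun u hu => hu.1).add
      (hX.continuousOn_M.mono fun u hu => hu.1)).add
      (hX.continuousOn_moment hc (a := fun n => (n : ℝ)) temperedOn_intCast t)
  · refine (((hX.hasDerivAt_L hu.1).add (hX.hasDerivAt_M hu.1)).add
      (hX.hasDerivAt_meanPos hc hβ hu.1)).congr_deriv ?_
    rw [fieldL_eq, fieldM_eq, heq]; ring

lemma meanGen_const_mul (x : WalkState) (r : ℝ) (a : ℤ → ℝ) :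
    r * meanGen c β x a = meanGen c β x fun n => r * a n := by
  rw [meanGen, meanGen, ← tsum_mul_left]
  congr 1; ext n; ring

lemma meanUp_eq_exp_mul (x : WalkState) : meanUp c β x
    = Real.exp (c * x.L) * ∑' n : ℤ, β n * Real.exp (-c * (n : ℝ)) * x.p n := by
  rw [meanUp, ← tsum_mul_left]
  congr 1; ext n; rw [rateUp_eq]; ring

lemma IsSolution.hasDerivAt_meanUp (hX : IsSolution c α β Clam Cmu X) (hc : 0 < c)
    (hβ : ∀ n, |β n| ≤ b₁) {t : ℝ} (ht : 0 < t) :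
    HasDerivAt (fun t => meanUp c β (X t)) (c * (Clam - meanUp c β (X t)) * meanUp c β (X t)
      + meanGen c β (X t) (rateUp c β (X t).L)) t := by
  set a : ℤ → ℝ := fun n => β n * Real.exp (-c * (n : ℝ))
  have ha : TemperedOn Set.univ fun _ => a :=
    (TemperedOn.of_bounded fun _ _ => hβ).mul (temperedOn_exp_mul _)
  have hup : ∀ L n, rateUp c β L n = Real.exp (c * L) * a n := fun L n => by
    rw [rateUp_eq]; simp only [a]; ring
  have hmean : ∀ x : WalkState, meanUp c β x = Real.exp (c * x.L) * ∑' n, a n * x.p n :=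
    meanUp_eq_exp_mul
  have h := (((hX.hasDerivAt_L ht).const_mul c).exp).mul (hX.hasDerivAt_moment hc hβ ha ht)
  rw [tsum_flux_mul_sub hβ (hX.rapidOn_p_const hc ht.le) ha] at h
  have hfun : (fun t => meanUp c β (X t))
      = fun t => Real.exp (c * (X t).L) * ∑' n, a n * (X t).p n := funext fun t => hmean _
  rw [hfun]
  refine h.congr_deriv ?_
  rw [meanGen_const_mul, show (rateUp c β (X t).L) = _ from funext (hup (X t).L), fieldL_eq,
    hmean]
  ring

lemma IsSolution.hasDerivAt_meanDown (hX : IsSolution c α β Clam Cmu X) (hc : 0 < c)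
    (hβ : ∀ n, |β n| ≤ b₁) {t : ℝ} (ht : 0 < t) :
    HasDerivAt (fun t => meanDown c β (X t))
      (c * (Cmu - meanDown c β (X t)) * meanDown c β (X t)
        + meanGen c β (X t) (rateDown c β (X t).M)) t := by
  set a : ℤ → ℝ := fun n => β (n - 1) * Real.exp (c * (n : ℝ))
  have ha : TemperedOn Set.univ fun _ => a :=
    (TemperedOn.of_bounded fun _ _ n => hβ (n - 1)).mul (temperedOn_exp_mul _)
  have hdn : ∀ M n, rateDown c β M n = Real.exp (-(c * M)) * a n := fun M n => by
    rw [rateDown_eq]; simp only [a]; ring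
  have hmean : ∀ x : WalkState, meanDown c β x = Real.exp (-(c * x.M)) * ∑' n, a n * x.p n := by
    intro x
    rw [meanDown, ← tsum_mul_left]
    congr 1; ext n; rw [hdn]; ring
  have h := (((hX.hasDerivAt_M ht).const_mul c).neg.exp).mul (hX.hasDerivAt_moment hc hβ ha ht)
  rw [tsum_flux_mul_sub hβ (hX.rapidOn_p_const hc ht.le) ha] at h
  have hfun : (fun t => meanDown c β (X t))
      = fun t => Real.exp (-(c * (X t).M)) * ∑' n, a n * (X t).p n := funext fun t => hmean _
  rw [hfun]
  refine h.congr_deriv ?_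
  rw [meanGen_const_mul, show (rateDown c β (X t).M) = _ from funext (hdn (X t).M), fieldM_eq,
    hmean]
  simp only [Pi.neg_apply]
  ring

/-- `L` and `M` stay bounded, and so do the mean rates. -/
lemma IsSolution.exists_bounds (hX : IsSolution c α β Clam Cmu X) (hc : 0 < c)
    (hb₀ : 0 < b₀) (hβ₀ : ∀ n, b₀ ≤ β n) (hβ : ∀ n, |β n| ≤ b₁)
    (hpos : 0 < Clam) (heq : Clam = Cmu) {C : ℝ} (hC : 0 < C)
    (hup : ∀ n, Real.exp (-c) * β (n + 1) - β n ≤ -C)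
    (hdn : ∀ n, Real.exp (-c) * β (n - 1) - β n ≤ -C)
    (hprob : ∀ t, 0 ≤ t → IsProbVec (X t).p) :
    ∃ R, ∀ t, 1 ≤ t → |(X t).L| ≤ R ∧ |(X t).M| ≤ R ∧
      meanUp c β (X t) ≤ R ∧ meanDown c β (X t) ≤ R := by
  subst heq
  have hb₁ : 0 < b₁ := hb₀.trans_le ((hβ₀ 0).trans ((le_abs_self _).trans (hβ 0)))
  have hβn : ∀ n, 0 ≤ β n := fun n => hb₀.le.trans (hβ₀ n)
  have hp := fun t (ht : 0 ≤ t) => hX.rapidOn_p_const hc ht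
  set U : ℝ → ℝ := fun t => meanUp c β (X t) with hUdef
  set V : ℝ → ℝ := fun t => meanDown c β (X t) with hVdef
  set m : ℝ → ℝ := fun t => meanPos (X t) with hmdef
  set D : ℝ → ℝ := fun t => (X t).L - (X t).M with hDdef
  set η := C / b₁ with hη
  have hη0 : 0 < η := by positivity
  have hU0 : ∀ t, 0 ≤ t → 0 ≤ U t := fun t ht => meanUp_nonneg hβn (hprob t ht).1
  have hV0 : ∀ t, 0 ≤ t → 0 ≤ V t := fun t ht => meanDown_nonneg hβn (hprob t ht).1
  have hUlo : ∀ t, 0 ≤ t → b₀ * (1 + c * ((X t).L - m t)) ≤ U t := fun t ht =>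
    le_meanUp hb₀.le hβ₀ hβ (hprob t ht) (hp t ht)
  have hVlo : ∀ t, 0 ≤ t → b₀ * (1 + c * (m t - (X t).M)) ≤ V t := fun t ht =>
    le_meanDown hb₀.le hβ₀ hβ (hprob t ht) (hp t ht)
  have hDd : ∀ t, 0 < t → HasDerivAt D (2 * Clam - U t - V t) t := fun t ht =>
    ((hX.hasDerivAt_L ht).sub (hX.hasDerivAt_M ht)).congr_deriv (by
      rw [fieldL_eq, fieldM_eq]; simp only [U, V]; ring)
  -- In the sum of the two lower bounds for the mean rates the mean position cancels, leaving linear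
  -- damping for D.
  obtain ⟨D₁, hD₁⟩ : ∃ D₁, ∀ t, 1 ≤ t → D t ≤ D₁ := by
    set r := (2 * Clam - 2 * b₀) / (b₀ * c)
    refine ⟨r + |D 1 - r|, fun t ht => ?_⟩
    have h := le_of_hasDerivAt_le_affine (b := 2 * Clam - 2 * b₀) (mul_pos hb₀ hc) ht
      (fun u hu => hDd u (by linarith [hu.1])) (fun u hu => by
        have h0 : 0 ≤ u := by linarith [hu.1]
        have h1 := hUlo u h0
        have h2 := hVlo u h0
        simp only [D]; linarith)
    refine h.trans (add_le_add le_rfl ?_)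
    refine (mul_le_mul_of_nonneg_right (le_abs_self _) (Real.exp_pos _).le).trans ?_
    refine mul_le_of_le_one_right (abs_nonneg _) (Real.exp_le_one_iff.2 ?_)
    have : 0 ≤ b₀ * c * (t - 1) := by
      have := sub_nonneg.2 ht; positivity
    linarith
  set Γ := b₁ ^ 2 * Real.exp c with hΓ
  have hΓ0 : 0 < Γ := by positivity
  set U' : ℝ → ℝ := fun t => c * (Clam - U t) * U t + meanGen c β (X t) (rateUp c β (X t).L)
  set V' : ℝ → ℝ := fun t => c * (Clam - V t) * V t + meanGen c β (X t) (rateDown c β (X t).M)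
  have hUd : ∀ t, 0 < t → HasDerivAt U (U' t) t := fun t ht => hX.hasDerivAt_meanUp hc hβ ht
  have hVd : ∀ t, 0 < t → HasDerivAt V (V' t) t := fun t ht => hX.hasDerivAt_meanDown hc hβ ht
  have hU' : ∀ t, 0 < t → U' t ≤ c * (Clam - U t) * U t - η * U t ^ 2
      + Γ * Real.exp (c * D t) := fun t ht => by
    have := meanGen_rateUp_le hb₁ hβn hβ hC.le hup (hprob t ht.le) (hp t ht.le)
    simp only [U', Γ, D, U, η]
    linarith
  have hV' : ∀ t, 0 < t → V' t ≤ c * (Clam - V t) * V t - η * V t ^ 2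
      + Γ * Real.exp (c * D t) := fun t ht => by
    have := meanGen_rateDown_le hb₁ hβn hβ hC.le hdn (hprob t ht.le) (hp t ht.le)
    simp only [V', Γ, D, V, η]
    linarith
  obtain ⟨Q, hQU, hQV⟩ : ∃ Q, (∀ t, 1 ≤ t → U t ≤ Q) ∧ ∀ t, 1 ≤ t → V t ≤ Q := by
    -- At any level Q ≥ Clam + y the logistic term is at most -c·Clam·y, which beats the largest
    -- possible forcing.
    set y := Γ * Real.exp (c * D₁) / (c * Clam) + 1
    have hy0 : 0 < y := by positivity
    have hy : Γ * Real.exp (c * D₁) < c * Clam * y := by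
      have : c * Clam * y = Γ * Real.exp (c * D₁) + c * Clam := by
        simp only [y]; field_simp
      rw [this]; have := mul_pos hc hpos; linarith
    set Q := max (max (U 1) (V 1)) (Clam + y)
    have hneg : ∀ t, 1 ≤ t →
        c * (Clam - Q) * Q - η * Q ^ 2 + Γ * Real.exp (c * D t) < 0 := by
      intro t ht
      have h1 : Real.exp (c * D t) ≤ Real.exp (c * D₁) :=
        Real.exp_le_exp.2 (mul_le_mul_of_nonneg_left (hD₁ t ht) hc.le)
      have h2 := mul_le_mul_of_nonneg_left h1 hΓ0.le
      have h3 : Clam + y ≤ Q := le_max_right _ _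
      have h4 : c * Clam * y ≤ c * Q * (Q - Clam) := by
        have : 0 ≤ Q := by linarith
        apply mul_le_mul (mul_le_mul_of_nonneg_left (by linarith) hc.le) (by linarith) hy0.le
        positivity
      have h5 := mul_nonneg hη0.le (sq_nonneg Q)
      linarith
    refine ⟨Q, fun t ht => ?_, fun t ht => ?_⟩
    · refine le_of_hasDerivAt_neg_at_barrier (f' := U')
        ((le_max_left _ _).trans (le_max_left _ _)) (fun u hu => hUd u (by linarith))
        (fun u hu hQ => ?_) ht
      have h1 := hU' u (by linarith)
      rw [hQ] at h1
      exact h1.trans_lt (hneg u hu)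
    · refine le_of_hasDerivAt_neg_at_barrier (f' := V')
        ((le_max_right _ _).trans (le_max_left _ _)) (fun u hu => hVd u (by linarith))
        (fun u hu hQ => ?_) ht
      have h1 := hV' u (by linarith)
      rw [hQ] at h1
      exact h1.trans_lt (hneg u hu)
  -- With this κ and η = 0 the expression in `hquad` would be (Clam - z)²/Clam, which vanishes at z
  -- = Clam. The damping η > 0 raises its minimum to δ.
  set κ := 1 / (c * Clam) with hκ
  have hκ0 : 0 < κ := by positivity
  set δ := Clam * (η / (c + η)) with hδ
  have hδ0 : 0 < δ := by positivity
  have hquad : ∀ z : ℝ, Clam - z - κ * (c * (Clam - z) * z - η * z ^ 2) ≥ δ := by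
    intro z
    have : Clam - z - κ * (c * (Clam - z) * z - η * z ^ 2) - δ
        = ((c + η) * z - c * Clam) ^ 2 / (c * Clam * (c + η)) := by
      simp only [hκ, hδ]; field_simp; ring
    have h2 : 0 ≤ ((c + η) * z - c * Clam) ^ 2 / (c * Clam * (c + η)) := by positivity
    linarith
  obtain ⟨D₀, hD₀⟩ : ∃ D₀, ∀ t, 1 ≤ t → D₀ ≤ D t := by
    -- The mean rates are bounded by Q, so a large G means a very negative D. The forcing is then
    -- negligible, and the gap δ makes G decrease.
    set G : ℝ → ℝ := fun t => κ * (U t + V t) - D t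
    set R := max (G 1) (κ * (2 * Q) - Real.log (δ / (κ * Γ)) / c + 1)
    have hG : ∀ t, 1 ≤ t → G t ≤ R := by
      intro t ht
      refine le_of_hasDerivAt_neg_at_barrier (le_max_left _ _)
        (f' := fun t => κ * (U' t + V' t) - (2 * Clam - U t - V t))
        (fun u hu => (((hUd u (by linarith)).add (hVd u (by linarith))).const_mul κ).sub
          (hDd u (by linarith))) (fun u hu hR => ?_) ht
      have h1 : κ * (2 * Q) - Real.log (δ / (κ * Γ)) / c + 1 ≤ R := le_max_right _ _
      have h2 : κ * (U u + V u) ≤ κ * (2 * Q) :=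
        mul_le_mul_of_nonneg_left (by linarith [hQU u hu, hQV u hu]) hκ0.le
      have h3 : D u < Real.log (δ / (κ * Γ)) / c := by
        change κ * (U u + V u) - D u = R at hR
        linarith
      have h4 : Real.exp (c * D u) < δ / (κ * Γ) := by
        rw [← Real.lt_log_iff_exp_lt (by positivity), mul_comm]
        exact (lt_div_iff₀ hc).1 h3
      have h5 : κ * (Γ * Real.exp (c * D u)) < δ := by
        rw [lt_div_iff₀ (by positivity)] at h4; linarith
      have h6 := mul_le_mul_of_nonneg_left (hU' u (by linarith)) hκ0.le
      have h7 := mul_le_mul_of_nonneg_left (hV' u (by linarith)) hκ0.le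
      have h8 := hquad (U u)
      have h9 := hquad (V u)
      linarith
    refine ⟨-R, fun t ht => ?_⟩
    have h1 := hG t ht
    have h2 := mul_nonneg hκ0.le
      (add_nonneg (hU0 t (by linarith)) (hV0 t (by linarith)))
    change κ * (U t + V t) - D t ≤ R at h1
    linarith
  set k := Q / (b₀ * c) with hk
  have hkU : ∀ t, 1 ≤ t → (X t).L - m t ≤ k := fun t ht => by
    have h1 := hUlo t (by linarith)
    have h2 := hQU t ht
    rw [hk, le_div_iff₀ (by positivity)]
    linarith
  have hkV : ∀ t, 1 ≤ t → m t - (X t).M ≤ k := fun t ht => by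
    have h1 := hVlo t (by linarith)
    have h2 := hQV t ht
    rw [hk, le_div_iff₀ (by positivity)]
    linarith
  set K := conservedK (X 0)
  have hK : ∀ t, 1 ≤ t → (X t).L + (X t).M + m t = K := fun t ht =>
    hX.conservedK_eq hc hβ rfl (by linarith)
  -- L - m and m - M are bounded above, and their sum L - M below. All mutual differences of L, M
  -- and m are thus bounded, and the conserved sum fixes their level.
  refine ⟨|K| + |D₀| + 2 * |k| + |Q|, fun t ht => ?_⟩
  have h1 := hkU t ht
  have h2 := hkV t ht
  have h3 := hK t ht
  have h4 := hD₀ t ht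
  simp only [D] at h4
  have a1 := le_abs_self K
  have a2 := neg_abs_le K
  have a3 := neg_abs_le D₀
  have a4 := le_abs_self k
  have a5 := le_abs_self Q
  have a6 := abs_nonneg K
  have a7 := abs_nonneg D₀
  have a8 := abs_nonneg k
  have a9 := abs_nonneg Q
  refine ⟨abs_le.2 ⟨?_, ?_⟩, abs_le.2 ⟨?_, ?_⟩, ?_, ?_⟩
  · linarith
  · linarith
  · linarith
  · linarith
  · linarith [hQU t ht]
  · linarith [hQV t ht]

end Dynamic

/-! ### Uniform control of the weighted tails -/

section Weights

variable {c : ℝ} {β : ℤ → ℝ} {b₀ b₁ R : ℝ}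

lemma mul_abs_intCast_add_le (α : ℝ) (n d : ℤ) :
    α * |(n : ℝ)| ≤ α * |((n + d : ℤ) : ℝ)| + |α| * |(d : ℝ)| := by
  have h : |(|(n : ℝ)| - |((n + d : ℤ) : ℝ)|)| ≤ |(d : ℝ)| := by
    have := abs_abs_sub_abs_le (n : ℝ) ((n + d : ℤ) : ℝ)
    simpa using this
  have h2 : α * (|(n : ℝ)| - |((n + d : ℤ) : ℝ)|) ≤ |α| * |(d : ℝ)| := by
    refine (le_abs_self _).trans ?_
    rw [abs_mul]
    exact mul_le_mul_of_nonneg_left h (abs_nonneg α)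
  linarith

/-- Rests on n²/2 - (n - 1) = (n - 1)²/2 + 1/2: the quadratic weight absorbs the growth of the rate,
so the weighted inflow is comparable to the weighted mass at its source. -/
lemma weightB_mul_rateUp_le (α : ℝ) (hc : 0 < c) (hβ : ∀ n, |β n| ≤ b₁)
    {L : ℝ} (hL : |L| ≤ R) (n : ℤ) :
    weightB c α n * rateUp c β L (n - 1)
      ≤ b₁ * Real.exp (c * R + c / 2 + |α|) * weightB c α (n - 1) := by
  have h1 : weightB c α n * rateUp c β L (n - 1) = β (n - 1) * Real.exp
      (c * (n : ℝ) ^ 2 / 2 + α * |(n : ℝ)| + -c * (((n - 1 : ℤ) : ℝ) - L)) := by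
    rw [Real.exp_add, weightB, rateUp]; ring
  rw [h1, mul_assoc, weightB, ← Real.exp_add]
  refine mul_le_mul ((le_abs_self _).trans (hβ _)) (Real.exp_le_exp.2 ?_) (Real.exp_pos _).le
    ((abs_nonneg _).trans (hβ 0))
  have h2 := mul_abs_intCast_add_le α n (-1)
  have h3 := mul_le_mul_of_nonneg_left ((le_abs_self L).trans hL) hc.le
  rw [← sub_eq_add_neg] at h2
  simp only [Int.cast_neg, Int.cast_one, abs_neg, abs_one, mul_one] at h2
  push_cast at h2 ⊢
  linarith

lemma weightB_mul_rateDown_le (α : ℝ) (hc : 0 < c) (hβ : ∀ n, |β n| ≤ b₁)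
    {M : ℝ} (hM : |M| ≤ R) (n : ℤ) :
    weightB c α n * rateDown c β M (n + 1)
      ≤ b₁ * Real.exp (c * R + c / 2 + |α|) * weightB c α (n + 1) := by
  have h1 : weightB c α n * rateDown c β M (n + 1) = β n * Real.exp
      (c * (n : ℝ) ^ 2 / 2 + α * |(n : ℝ)| + c * (((n + 1 : ℤ) : ℝ) - M)) := by
    rw [Real.exp_add, weightB, rateDown, add_sub_cancel_right]; ring
  rw [h1, mul_assoc, weightB, ← Real.exp_add]
  refine mul_le_mul ((le_abs_self _).trans (hβ _)) (Real.exp_le_exp.2 ?_) (Real.exp_pos _).le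
    ((abs_nonneg _).trans (hβ 0))
  have h2 := mul_abs_intCast_add_le α n 1
  have h3 := mul_le_mul_of_nonneg_left ((neg_le_abs M).trans hM) hc.le
  simp only [Int.cast_one, abs_one, mul_one] at h2
  push_cast at h2 ⊢
  linarith

/-- The downward rate is large far to the right and the upward rate far to the left. -/
lemma le_rateUp_add_rateDown (hc : 0 < c) (hb₀ : 0 < b₀) (hβ₀ : ∀ n, b₀ ≤ β n) {L M r : ℝ}
    (hL : |L| ≤ R) (hM : |M| ≤ R) {n : ℤ} (hn : r ≤ |(n : ℝ)|) :
    b₀ * Real.exp (c * (r - R)) ≤ rateUp c β L n + rateDown c β M n := by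
  have hU : 0 ≤ rateUp c β L n := mul_nonneg (hb₀.le.trans (hβ₀ _)) (Real.exp_pos _).le
  have hD : 0 ≤ rateDown c β M n := mul_nonneg (hb₀.le.trans (hβ₀ _)) (Real.exp_pos _).le
  rcases abs_cases (n : ℝ) with ⟨h, -⟩ | ⟨h, -⟩ <;> rw [h] at hn
  · refine le_add_of_nonneg_of_le hU (mul_le_mul (hβ₀ _) (Real.exp_le_exp.2 ?_)
      (Real.exp_pos _).le (hb₀.le.trans (hβ₀ _)))
    exact mul_le_mul_of_nonneg_left (by linarith [(abs_le.1 hM).2]) hc.le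
  · refine le_add_of_le_of_nonneg (mul_le_mul (hβ₀ _) (Real.exp_le_exp.2 ?_)
      (Real.exp_pos _).le (hb₀.le.trans (hβ₀ _))) hD
    rw [neg_mul, ← mul_neg]
    exact mul_le_mul_of_nonneg_left (by linarith [(abs_le.1 hL).1]) hc.le

end Weights

lemma IsProbVec.le_one {q : ℤ → ℝ} (hq : IsProbVec q) (n : ℤ) : q n ≤ 1 :=
  le_hasSum hq.2 n fun m _ => hq.1 m

lemma sum_shift_le_tsum {f : ℤ → ℝ} (hf : Summable f) (h0 : ∀ n, 0 ≤ f n) (A : Finset ℤ)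
    (d : ℤ) : ∑ n ∈ A, f (n + d) ≤ ∑' n, f n := by
  rw [← tsum_int_shift f d]
  exact (summable_int_shift hf d).sum_le_tsum A fun _ _ => h0 _

section Tails

variable {c α : ℝ} {β : ℤ → ℝ} {Clam Cmu : ℝ} {X : ℝ → WalkState} {b₀ b₁ R : ℝ}

/-- The weighted mass of a finite set far from the origin gains at rate at most 2A₁E and is lost at
rate at least g; then Grönwall. The bound does not depend on the set, so it passes to whole tails.
-/
lemma IsSolution.sum_weight_le (hX : IsSolution c α β Clam Cmu X) (hc : 0 < c)
    (hb₀ : 0 < b₀) (hβ₀ : ∀ n, b₀ ≤ β n) (hβ : ∀ n, |β n| ≤ b₁)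
    (hprob : ∀ t, 0 ≤ t → IsProbVec (X t).p)
    (hR : ∀ t, 1 ≤ t → |(X t).L| ≤ R ∧ |(X t).M| ≤ R) {E r t : ℝ} (ht : 1 ≤ t)
    (hE : ∀ u ∈ Set.Icc 1 t, normB c α (X u).p ≤ E) {A : Finset ℤ}
    (hA : ∀ n ∈ A, r ≤ |(n : ℝ)|) :
    ∑ n ∈ A, |(X t).p n| * weightB c α n
      ≤ 2 * (b₁ * Real.exp (c * R + c / 2 + |α|)) * E / (b₀ * Real.exp (c * (r - R)))
        + normB c α (X 1).p * Real.exp (-(b₀ * Real.exp (c * (r - R))) * (t - 1)) := by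
  set A₁ := b₁ * Real.exp (c * R + c / 2 + |α|)
  set g := b₀ * Real.exp (c * (r - R)) with hg
  have hg0 : 0 < g := by positivity
  have hA₁ : 0 ≤ A₁ := mul_nonneg ((abs_nonneg _).trans (hβ 0)) (Real.exp_pos _).le
  have hd : ∀ u ∈ Set.Icc 1 t, HasDerivAt (fun u => ∑ n ∈ A, (X u).p n * weightB c α n)
      (∑ n ∈ A, (flux c β (X u) (n - 1) - flux c β (X u) n) * weightB c α n) u := fun u hu =>
    HasDerivAt.fun_sum fun n _ =>
      (hX.hasDerivAt_p (by linarith [hu.1]) n).mul_const (weightB c α n)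
  have hle : ∀ u ∈ Set.Icc 1 t,
      ∑ n ∈ A, (flux c β (X u) (n - 1) - flux c β (X u) n) * weightB c α n
        ≤ 2 * A₁ * E - g * ∑ n ∈ A, (X u).p n * weightB c α n := by
    intro u hu
    have hu0 : 0 ≤ u := by linarith [hu.1]
    have hp0 := (hprob u hu0).1
    set f : ℤ → ℝ := fun n => |(X u).p n| * weightB c α n
    have hf : ∀ n, f n = (X u).p n * weightB c α n := fun n => by
      simp only [f, abs_of_nonneg (hp0 n)]
    have hf0 : ∀ n, 0 ≤ f n := fun n => mul_nonneg (abs_nonneg _) (weightB_pos c α n).le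
    have hfs : Summable f := hX.memB u hu0
    have hfE : ∑' n, f n ≤ E := hE u hu
    obtain ⟨hL, hM⟩ := hR u hu.1
    have hpt : ∀ n ∈ A, (flux c β (X u) (n - 1) - flux c β (X u) n) * weightB c α n
        ≤ A₁ * f (n - 1) + A₁ * f (n + 1) - g * f n := by
      intro n hn
      have h1 := mul_le_mul_of_nonneg_right
        (weightB_mul_rateUp_le α hc hβ hL n) (hp0 (n - 1))
      have h2 := mul_le_mul_of_nonneg_right
        (weightB_mul_rateDown_le α hc hβ hM n) (hp0 (n + 1))
      have h3 := mul_le_mul_of_nonneg_right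
        (le_rateUp_add_rateDown (β := β) hc hb₀ hβ₀ hL hM (hA n hn)) (hf0 n)
      rw [hf] at h3
      rw [hf, hf, hf]
      simp only [flux, sub_add_cancel]
      linarith
    refine (Finset.sum_le_sum hpt).trans ?_
    rw [Finset.sum_sub_distrib, Finset.sum_add_distrib, ← Finset.mul_sum, ← Finset.mul_sum,
      ← Finset.mul_sum]
    have h1 : ∑ n ∈ A, f (n - 1) ≤ E := (sum_shift_le_tsum hfs hf0 A (-1)).trans hfE
    have h2 : ∑ n ∈ A, f (n + 1) ≤ E := (sum_shift_le_tsum hfs hf0 A 1).trans hfE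
    have h3 := mul_le_mul_of_nonneg_left h1 hA₁
    have h4 := mul_le_mul_of_nonneg_left h2 hA₁
    simp only [hf] at h3 h4 ⊢
    linarith
  have key := le_of_hasDerivAt_le_affine hg0 ht hd hle
  have hE0 : 0 ≤ E := (normB_nonneg c α _).trans (hE 1 ⟨le_rfl, ht⟩)
  have h1 : ∑ n ∈ A, |(X t).p n| * weightB c α n = ∑ n ∈ A, (X t).p n * weightB c α n :=
    Finset.sum_congr rfl fun n _ => by
      rw [abs_of_nonneg ((hprob t (by linarith)).1 n)]
  have h2 : ∑ n ∈ A, (X 1).p n * weightB c α n ≤ normB c α (X 1).p := by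
    refine (Finset.sum_le_sum fun n _ => ?_).trans ((hX.memB 1 zero_le_one).sum_le_tsum A
      fun n _ => mul_nonneg (abs_nonneg _) (weightB_pos c α n).le)
    exact mul_le_mul_of_nonneg_right (le_abs_self _) (weightB_pos c α n).le
  rw [h1]
  refine key.trans (add_le_add le_rfl (mul_le_mul_of_nonneg_right ?_ (Real.exp_pos _).le))
  have : 0 ≤ 2 * A₁ * E / g := by positivity
  linarith

lemma exists_nat_le_mul_exp (hc : 0 < c) (hb₀ : 0 < b₀) (R y : ℝ) :
    ∃ r : ℕ, y ≤ b₀ * Real.exp (c * ((r : ℝ) - R)) := by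
  obtain ⟨r, hr⟩ := exists_nat_ge (R + y / (b₀ * c))
  refine ⟨r, ?_⟩
  have h1 := Real.add_one_le_exp (c * ((r : ℝ) - R))
  have h2 : y / (b₀ * c) ≤ (r : ℝ) - R := by linarith
  rw [div_le_iff₀ (by positivity)] at h2
  have h3 := mul_le_mul_of_nonneg_left h1 hb₀.le
  linarith

/-- Absorption: with E the maximum of the norm on [1, t], choose r so that inflow contributes at
most E/2 to the tail. The core is at most the sum of its weights, since p n ≤ 1. -/
lemma IsSolution.exists_normB_le (hX : IsSolution c α β Clam Cmu X) (hc : 0 < c)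
    (hb₀ : 0 < b₀) (hβ₀ : ∀ n, b₀ ≤ β n) (hβ : ∀ n, |β n| ≤ b₁)
    (hprob : ∀ t, 0 ≤ t → IsProbVec (X t).p)
    (hR : ∀ t, 1 ≤ t → |(X t).L| ≤ R ∧ |(X t).M| ≤ R) :
    ∃ E, ∀ t, 1 ≤ t → normB c α (X t).p ≤ E := by
  set A₁ := b₁ * Real.exp (c * R + c / 2 + |α|)
  obtain ⟨r, hr⟩ := exists_nat_le_mul_exp hc hb₀ R (4 * A₁)
  set g := b₀ * Real.exp (c * ((r : ℝ) - R))
  have hg0 : 0 < g := by positivity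
  set W := ∑ n ∈ Finset.Icc (-(r : ℤ)) r, weightB c α n
  refine ⟨2 * (W + normB c α (X 1).p), fun t ht => ?_⟩
  obtain ⟨τ, hτ, hmax⟩ := isCompact_Icc.exists_isMaxOn (Set.nonempty_Icc.2 ht)
    (hX.continuousOn_normB.mono (fun u hu => zero_le_one.trans hu.1 :
      Set.Icc 1 t ⊆ Set.Ici 0))
  refine (hmax (Set.right_mem_Icc.2 ht)).trans ?_
  set E := normB c α (X τ).p with hEdef
  have hE0 : 0 ≤ E := normB_nonneg _ _ _
  have hpτ := hprob τ (by linarith [hτ.1])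
  have hfin : E ≤ W + (E / 2 + normB c α (X 1).p) := by
    refine Real.tsum_le_of_sum_le
      (fun n => mul_nonneg (abs_nonneg _) (weightB_pos c α n).le) fun A => ?_
    rw [← Finset.sum_filter_add_sum_filter_not A (fun n => n ∈ Finset.Icc (-(r : ℤ)) r)]
    refine add_le_add ?_ ?_
    · refine (Finset.sum_le_sum (g := fun n => weightB c α n) fun n _ => ?_).trans
        (Finset.sum_le_sum_of_subset_of_nonneg (fun n hn => (Finset.mem_filter.1 hn).2)
          fun n _ _ => (weightB_pos c α n).le)
      rw [abs_of_nonneg (hpτ.1 n)]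
      exact mul_le_of_le_one_left (weightB_pos c α n).le (hpτ.le_one n)
    · refine (hX.sum_weight_le hc hb₀ hβ₀ hβ hprob hR (E := E) (r := r) hτ.1 (fun u hu =>
        hmax ⟨hu.1, hu.2.trans hτ.2⟩) fun n hn => ?_).trans (add_le_add ?_ ?_)
      · have h1 := (Finset.mem_filter.1 hn).2
        rw [Finset.mem_Icc, ← abs_le, not_le] at h1
        exact_mod_cast h1.le
      · rw [div_le_iff₀ hg0]
        have := mul_le_mul_of_nonneg_left hr hE0
        linarith
      · refine mul_le_of_le_one_right (normB_nonneg _ _ _) (Real.exp_le_one_iff.2 ?_)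
        have : 0 ≤ g * (τ - 1) := mul_nonneg hg0.le (by linarith [hτ.1])
        linarith
  linarith

/-- The weighted tails are eventually small, uniformly in time. -/
lemma IsSolution.exists_tail_le (hX : IsSolution c α β Clam Cmu X) (hc : 0 < c)
    (hb₀ : 0 < b₀) (hβ₀ : ∀ n, b₀ ≤ β n) (hβ : ∀ n, |β n| ≤ b₁)
    (hprob : ∀ t, 0 ≤ t → IsProbVec (X t).p)
    (hR : ∀ t, 1 ≤ t → |(X t).L| ≤ R ∧ |(X t).M| ≤ R) {ε : ℝ} (hε : 0 < ε) :
    ∃ r : ℕ, ∀ᶠ t in atTop, ∀ A : Finset ℤ, (∀ n ∈ A, (r : ℝ) ≤ |(n : ℝ)|) →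
      ∑ n ∈ A, |(X t).p n| * weightB c α n ≤ ε := by
  obtain ⟨E, hE⟩ := hX.exists_normB_le hc hb₀ hβ₀ hβ hprob hR
  have hE0 : 0 ≤ E := (normB_nonneg c α _).trans (hE 1 le_rfl)
  set A₁ := b₁ * Real.exp (c * R + c / 2 + |α|)
  obtain ⟨r, hr⟩ := exists_nat_le_mul_exp hc hb₀ R (2 * A₁ * E / (ε / 2))
  set g := b₀ * Real.exp (c * ((r : ℝ) - R))
  have hg0 : 0 < g := by positivity
  refine ⟨r, ?_⟩
  have hexp : Tendsto (fun t => normB c α (X 1).p * Real.exp (-g * (t - 1))) atTop (𝓝 0) := by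
    have h1 : Tendsto (fun t => -g * (t - 1)) atTop atBot := by
      apply Tendsto.const_mul_atTop_of_neg (by linarith)
      exact tendsto_atTop_add_const_right _ _ tendsto_id
    simpa using (Real.tendsto_exp_atBot.comp h1).const_mul (normB c α (X 1).p)
  filter_upwards [hexp.eventually_le_const (half_pos hε), eventually_ge_atTop 1] with t h1 ht A hA
  refine (hX.sum_weight_le hc hb₀ hβ₀ hβ hprob hR ht (fun u hu => hE u hu.1) hA).trans ?_
  have h2 : 2 * A₁ * E / g ≤ ε / 2 := by
    rw [div_le_iff₀ (by positivity)] at hr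
    rw [div_le_iff₀ hg0]
    linarith
  linarith

end Tails

/-! ### The free energy -/

lemma RapidOn.sqrt {s : Set ℝ} {u : ℝ → ℤ → ℝ} (hu : RapidOn s u) :
    RapidOn s fun t n => √(u t n) := fun k => by
  obtain ⟨K, hK, hb⟩ := hu (2 * k)
  refine ⟨√K, Real.sqrt_nonneg _, fun t ht n => ?_⟩
  rw [abs_of_nonneg (Real.sqrt_nonneg _)]
  refine Real.sqrt_le_iff.2 ⟨by positivity, (le_abs_self _).trans ((hb t ht n).trans ?_)⟩
  rw [mul_pow, Real.sq_sqrt hK, ← Real.exp_nat_mul]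
  refine le_of_eq ?_
  congr 2; push_cast; ring

/-- A quantity whose square is dissipated by a bounded below functional tends to zero if it is
Lipschitz continuous. -/
lemma tendsto_zero_of_dissipation {F J : ℝ → ℝ} {B l κ : ℝ} (hκ : 0 < κ)
    (hB : ∀ t, 1 ≤ t → B ≤ F t)
    (hJ : ∀ s t, 1 ≤ s → s ≤ t → |J t - J s| ≤ l * (t - s))
    (hF : ∀ s t δ, 1 ≤ s → s ≤ t → (∀ u ∈ Set.Icc s t, δ ≤ J u ^ 2) →
      F t ≤ F s - κ * δ * (t - s)) : Tendsto J atTop (𝓝 0) := by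
  have hanti : Antitone fun t => F (max t 1) := fun s t hst => by
    have := hF (max s 1) (max t 1) 0 (le_max_right _ _) (max_le_max hst le_rfl)
      (fun u _ => sq_nonneg _)
    simpa using this
  have hlim := tendsto_atTop_ciInf hanti ⟨B, by rintro _ ⟨t, rfl⟩; exact hB _ (le_max_right _ _)⟩
  rw [Metric.tendsto_atTop]
  intro ε hε
  have hl : 0 ≤ |l| := abs_nonneg l
  -- If |J t| ≥ ε, then |J| ≥ ε/2 on [t, t + τ], which costs F a fixed amount. That is impossible at
  -- late times, because F converges.
  set τ := ε / (2 * (|l| + 1)) with hτ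
  have hτ0 : 0 < τ := by positivity
  have hdiff := hlim.sub (hlim.comp (tendsto_atTop_add_const_right atTop τ tendsto_id))
  rw [sub_self] at hdiff
  obtain ⟨t₀, ht₀⟩ := eventually_atTop.1
    (hdiff.eventually_lt_const (u := κ * (ε / 2) ^ 2 * τ) (by positivity))
  refine ⟨max t₀ 1, fun t ht => ?_⟩
  have h1 : 1 ≤ t := (le_max_right _ _).trans ht
  have h2 := ht₀ t ((le_max_left _ _).trans ht)
  simp only [Function.comp_apply, id, max_eq_left h1, max_eq_left (by linarith : 1 ≤ t + τ)] at h2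
  by_contra! hcon
  rw [Real.dist_eq, sub_zero] at hcon
  have h3 := hF t (t + τ) ((ε / 2) ^ 2) h1 (by linarith) fun u hu => by
    have h4 := hJ t u h1 hu.1
    have h5 : l * (u - t) ≤ ε / 2 := by
      have h6 : l * (u - t) ≤ (|l| + 1) * τ :=
        mul_le_mul (by linarith [le_abs_self l]) (by linarith [hu.2]) (by linarith [hu.1])
          (by positivity)
      have h7 : (|l| + 1) * τ = ε / 2 := by rw [hτ]; field_simp
      linarith
    have h8 := abs_sub_abs_le_abs_sub (J t) (J u)
    rw [abs_sub_comm] at h8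
    rw [← sq_abs (J u)]
    exact pow_le_pow_left₀ (by positivity) (by linarith) 2
  rw [add_sub_cancel_left] at h3
  linarith

/-- The relative entropy density of the mass `x` at `n` with respect to `exp (-c n²)`. -/
def entropyTerm (c : ℝ) (n : ℤ) (x : ℝ) : ℝ :=
  x * Real.log x + c * (n : ℝ) ^ 2 * x - x + Real.exp (-(c * (n : ℝ) ^ 2))

/-- Use log z ≤ z - 1 at z = exp(-cn²)/x. The last two terms of the density serve only to make each
summand nonnegative. -/
lemma entropyTerm_nonneg (c : ℝ) (n : ℤ) {x : ℝ} (hx : 0 < x) : 0 ≤ entropyTerm c n x := by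
  have hq := Real.exp_pos (-(c * (n : ℝ) ^ 2))
  have h := Real.log_le_sub_one_of_pos (div_pos hq hx)
  rw [Real.log_div hq.ne' hx.ne', Real.log_exp] at h
  have h2 := mul_le_mul_of_nonneg_left h hx.le
  have h3 : x * (Real.exp (-(c * (n : ℝ) ^ 2)) / x - 1) = Real.exp (-(c * (n : ℝ) ^ 2)) - x := by
    field_simp
  rw [entropyTerm]
  linarith

lemma entropyTerm_le (c : ℝ) (n : ℤ) {x : ℝ} (hx : 0 < x) (hx1 : x ≤ 1) :
    entropyTerm c n x ≤ c * (x * (n : ℝ) ^ 2) + Real.exp (-(c * (n : ℝ) ^ 2)) := by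
  have h := mul_nonpos_of_nonneg_of_nonpos hx.le (Real.log_nonpos hx.le hx1)
  rw [entropyTerm]
  linarith

lemma hasDerivAt_entropyTerm (c : ℝ) (n : ℤ) {x : ℝ} (hx : 0 < x) :
    HasDerivAt (entropyTerm c n) (Real.log x + c * (n : ℝ) ^ 2) x := by
  have h := (((Real.hasDerivAt_mul_log hx.ne').add
    ((hasDerivAt_id x).const_mul (c * (n : ℝ) ^ 2))).sub (hasDerivAt_id x)).add_const
    (Real.exp (-(c * (n : ℝ) ^ 2)))
  exact h.congr_deriv (by ring)

lemma temperedOn_sq {s : Set ℝ} : TemperedOn s fun _ n => (n : ℝ) ^ 2 := by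
  simpa only [sq] using temperedOn_intCast.mul temperedOn_intCast

lemma summable_exp_neg_sq {c : ℝ} (hc : 0 < c) :
    Summable fun n : ℤ => Real.exp (-(c * (n : ℝ) ^ 2)) := by
  have h : RapidOn Set.univ fun _ n => Real.exp (-(c * (n : ℝ) ^ 2)) :=
    rapidOn_of_mul_weightB_le (c := 2 * c) (α := 0) (B := 1) (by linarith) fun t _ n => by
      rw [Real.abs_exp, weightB, ← Real.exp_add]
      refine Real.exp_le_one_iff.2 (le_of_eq ?_)
      ring
  exact h.summable (Set.mem_univ (0 : ℝ))

/-- The Lyapunov functional of the system. -/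
def freeEnergy (c : ℝ) (x : WalkState) : ℝ :=
  ∑' n, entropyTerm c n (x.p n) + c * (x.L + x.M) ^ 2 / 2

/-- The free energy dissipated by the jumps across the edge from `n` to `n + 1`. -/
def dissipation (c : ℝ) (β : ℤ → ℝ) (x : WalkState) (n : ℤ) : ℝ :=
  flux c β x n * (Real.log (rateUp c β x.L n * x.p n)
    - Real.log (rateDown c β x.M (n + 1) * x.p (n + 1)))

lemma log_rateUp_mul {c : ℝ} {β : ℤ → ℝ} (hβ : ∀ n, 0 < β n) (L : ℝ) (n : ℤ) {y : ℝ}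
    (hy : 0 < y) : Real.log (rateUp c β L n * y) = Real.log (β n) - c * (n - L) + Real.log y := by
  rw [rateUp, Real.log_mul (mul_pos (hβ n) (Real.exp_pos _)).ne' hy.ne',
    Real.log_mul (hβ n).ne' (Real.exp_pos _).ne', Real.log_exp]
  ring

lemma log_rateDown_mul {c : ℝ} {β : ℤ → ℝ} (hβ : ∀ n, 0 < β n) (M : ℝ) (n : ℤ) {y : ℝ}
    (hy : 0 < y) :
    Real.log (rateDown c β M (n + 1) * y) = Real.log (β n) + c * (n + 1 - M) + Real.log y := by
  rw [rateDown, add_sub_cancel_right, Real.log_mul (mul_pos (hβ n) (Real.exp_pos _)).ne' hy.ne',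
    Real.log_mul (hβ n).ne' (Real.exp_pos _).ne', Real.log_exp]
  push_cast; ring

/-- β(n) cancels between the two logarithms, and c(2n + 1) is the increment of cn². The remaining
c(L + M) is matched by the quadratic part of the free energy. -/
lemma dissipation_eq {c : ℝ} {β : ℤ → ℝ} (hβ : ∀ n, 0 < β n) {x : WalkState}
    (hp : ∀ n, 0 < x.p n) (n : ℤ) :
    -dissipation c β x n = flux c β x n * ((Real.log (x.p (n + 1)) + c * ((n + 1 : ℤ) : ℝ) ^ 2)
      - (Real.log (x.p n) + c * (n : ℝ) ^ 2)) - c * (x.L + x.M) * flux c β x n := by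
  rw [dissipation, log_rateUp_mul hβ _ _ (hp n), log_rateDown_mul hβ _ _ (hp (n + 1))]
  push_cast; ring

lemma dissipation_nonneg {c : ℝ} {β : ℤ → ℝ} (hβ : ∀ n, 0 < β n) {x : WalkState}
    (hp : ∀ n, 0 < x.p n) (n : ℤ) : 0 ≤ dissipation c β x n :=
  mul_log_sub_log_nonneg (mul_pos (mul_pos (hβ _) (Real.exp_pos _)) (hp n))
    (mul_pos (mul_pos (hβ _) (Real.exp_pos _)) (hp (n + 1)))

/-- Facts about a solution after it has entered a bounded region. -/
structure BoundedFlow (c : ℝ) (β : ℤ → ℝ) (C K R : ℝ) (X : ℝ → WalkState) : Prop where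
  rapid : RapidOn (Set.Ici 1) fun t => (X t).p
  prob : ∀ t, 1 ≤ t → IsProbVec (X t).p
  pos : ∀ t, 1 ≤ t → ∀ n, 0 < (X t).p n
  abs_L_le : ∀ t, 1 ≤ t → |(X t).L| ≤ R
  abs_M_le : ∀ t, 1 ≤ t → |(X t).M| ≤ R
  meanUp_le : ∀ t, 1 ≤ t → meanUp c β (X t) ≤ R
  meanDown_le : ∀ t, 1 ≤ t → meanDown c β (X t) ≤ R
  deriv_p : ∀ t, 1 ≤ t → ∀ n,
    HasDerivAt (fun t => (X t).p n) (flux c β (X t) (n - 1) - flux c β (X t) n) t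
  deriv_L : ∀ t, 1 ≤ t → HasDerivAt (fun t => (X t).L) (C - meanUp c β (X t)) t
  deriv_M : ∀ t, 1 ≤ t → HasDerivAt (fun t => (X t).M) (meanDown c β (X t) - C) t
  conserved : ∀ t, 1 ≤ t → (X t).L + (X t).M + meanPos (X t) = K

namespace BoundedFlow

variable {c : ℝ} {β : ℤ → ℝ} {C K R b₁ : ℝ} {X : ℝ → WalkState}

lemma rapidOn_flux (hX : BoundedFlow c β C K R X) (hβ : ∀ n, |β n| ≤ b₁) :
    RapidOn (Set.Ici 1) fun t => flux c β (X t) :=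
  _root_.rapidOn_flux hβ hX.abs_L_le hX.abs_M_le hX.rapid

lemma summable_entropyTerm (hX : BoundedFlow c β C K R X) (hc : 0 < c) {t : ℝ} (ht : 1 ≤ t) :
    Summable fun n => entropyTerm c n ((X t).p n) := by
  refine Summable.of_nonneg_of_le (fun n => entropyTerm_nonneg c n (hX.pos t ht n))
    (fun n => entropyTerm_le c n (hX.pos t ht n) ((hX.prob t ht).le_one n)) ?_
  exact (((hX.rapid.mul_tempered temperedOn_sq).summable (Set.mem_Ici.2 ht)).mul_left c).add
    (summable_exp_neg_sq hc)

lemma freeEnergy_nonneg (hX : BoundedFlow c β C K R X) (hc : 0 < c) {t : ℝ} (ht : 1 ≤ t) :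
    0 ≤ freeEnergy c (X t) :=
  add_nonneg (tsum_nonneg fun n => entropyTerm_nonneg c n (hX.pos t ht n)) (by positivity)

/-- Truncated free energies dissipate up to errors which vanish uniformly in time. -/
lemma exists_deriv_truncated_le (hX : BoundedFlow c β C K R X) (hβ : ∀ n, |β n| ≤ b₁)
    (hβ₀ : ∀ n, 0 < β n) (hc : 0 < c) (k : ℤ) :
    ∃ ε : ℕ → ℝ, Tendsto ε atTop (𝓝 0) ∧ ∀ N : ℕ, k ∈ Finset.Ico (-(N : ℤ)) N → ∀ t, 1 ≤ t →
      ∑ n ∈ Finset.Icc (-(N : ℤ)) N, (Real.log ((X t).p n) + c * (n : ℝ) ^ 2)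
          * (flux c β (X t) (n - 1) - flux c β (X t) n)
        + c * ((X t).L + (X t).M) * (meanDown c β (X t) - meanUp c β (X t))
      ≤ -dissipation c β (X t) k + ε N := by
  have hU : TemperedOn (Set.Ici 1) fun t n => rateUp c β (X t).L n :=
    temperedOn_rateUp hβ hX.abs_L_le
  have hD : TemperedOn (Set.Ici 1) fun t n => rateDown c β (X t).M n :=
    temperedOn_rateDown hβ hX.abs_M_le
  have hJ := hX.rapidOn_flux hβ
  have hS : TemperedOn (Set.Ici 1) fun t (_ : ℤ) => c * ((X t).L + (X t).M) := by
    refine TemperedOn.of_bounded (K := c * (R + R)) fun t ht _ => ?_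
    rw [abs_mul, abs_of_pos hc]
    exact mul_le_mul_of_nonneg_left ((abs_add_le _ _).trans
      (add_le_add (hX.abs_L_le t ht) (hX.abs_M_le t ht))) hc.le
  have hsq : TemperedOn (Set.Ici 1) fun _ n => c * (n : ℝ) ^ 2 :=
    (temperedOn_const c).mul temperedOn_sq
  -- Majorants for everything that edges outside the truncation can contribute. Rapid decay makes
  -- their sum small uniformly in time.
  set e₁ : ℝ → ℤ → ℝ := fun t n => |c * ((X t).L + (X t).M) * flux c β (X t) n|
  set e₂ : ℝ → ℤ → ℝ := fun t n => rateUp c β (X t).L n * (2 * √((X t).p n))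
  set e₃ : ℝ → ℤ → ℝ := fun t n => rateDown c β (X t).M (n + 1) * (2 * √((X t).p (n + 1)))
  set e₄ : ℝ → ℤ → ℝ := fun t n =>
    rateUp c β (X t).L n * (X t).p n * (c * ((n + 1 : ℤ) : ℝ) ^ 2)
  set e₅ : ℝ → ℤ → ℝ := fun t n =>
    rateDown c β (X t).M (n + 1) * (X t).p (n + 1) * (c * (n : ℝ) ^ 2)
  have hsqrt : RapidOn (Set.Ici 1) fun t n => 2 * √((X t).p n) :=
    (temperedOn_const 2).mul_rapid hX.rapid.sqrt
  have he : RapidOn (Set.Ici 1) fun t n =>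
      e₁ t n + e₂ t n + e₃ t n + e₄ t n + e₅ t n :=
    ((((hS.mul_rapid hJ).abs.add (hU.mul_rapid hsqrt)).add ((hD.mul_rapid hsqrt).shift 1)).add
      ((hU.mul_rapid hX.rapid).mul_tempered (hsq.shift 1))).add
      (((hD.mul_rapid hX.rapid).shift 1).mul_tempered hsq)
  obtain ⟨U, hUs, hUb⟩ := he.exists_summable_bound
  have hU0 : ∀ n, 0 ≤ U n := fun n => (abs_nonneg _).trans (hUb 1 (Set.mem_Ici.2 le_rfl) n)
  set tail : ℕ → ℤ → ℝ := fun N n => if n ∈ Finset.Ico (-(N : ℤ)) N then 0 else U n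
  have htail0 : ∀ N n, 0 ≤ tail N n := fun N n => by
    simp only [tail]; split_ifs
    exacts [le_rfl, hU0 n]
  have htailU : ∀ N n, ‖tail N n‖ ≤ U n := fun N n => by
    rw [Real.norm_eq_abs, abs_of_nonneg (htail0 N n)]
    simp only [tail]; split_ifs
    exacts [hU0 n, le_rfl]
  have htails : ∀ N, Summable (tail N) := fun N => Summable.of_norm_bounded hUs (htailU N)
  refine ⟨fun N => ∑' n, tail N n, ?_, fun N hk t ht => ?_⟩
  · have : Tendsto (fun N => ∑' n, tail N n) atTop (𝓝 (∑' _ : ℤ, (0 : ℝ))) := by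
      refine tendsto_tsum_of_dominated_convergence hUs (fun n => ?_)
        (Eventually.of_forall htailU)
      refine tendsto_const_nhds.congr' ?_
      filter_upwards [eventually_gt_atTop n.natAbs] with N hN
      have : n ∈ Finset.Ico (-(N : ℤ)) N := by rw [Finset.mem_Ico]; omega
      simp only [tail, if_pos this]
    simpa using this
  have hp := hX.pos t ht
  have hp1 := (hX.prob t ht).le_one
  have htm : t ∈ Set.Ici (1 : ℝ) := ht
  set J := flux c β (X t) with hJdef
  set σ := c * ((X t).L + (X t).M)
  set l : ℤ → ℝ := fun n => Real.log ((X t).p n) + c * (n : ℝ) ^ 2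
  set a : ℤ → ℝ := fun n => if n ∈ Finset.Icc (-(N : ℤ)) N then l n else 0 with ha
  have hJs : Summable J := hJ.summable htm
  have hmean : meanDown c β (X t) - meanUp c β (X t) = -∑' n, J n := by
    rw [tsum_flux hβ (hX.rapid.const_of_mem htm)]; ring
  have hfin : ∀ f : ℤ → ℝ, Summable fun n => a n * f n := fun f =>
    summable_of_ne_finset_zero (s := Finset.Icc (-(N : ℤ)) N) fun n hn => by
      simp only [ha, if_neg hn, zero_mul]
  have hfin' : Summable fun n => a (n + 1) * J n := by
    have := summable_int_shift (hfin fun n => J (n - 1)) 1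
    simpa using this
  have hsum : ∑ n ∈ Finset.Icc (-(N : ℤ)) N, l n * (J (n - 1) - J n)
      = ∑' n, J n * (a (n + 1) - a n) := by
    rw [← tsum_mul_sub_shift (hfin J) hfin', tsum_eq_sum (s := Finset.Icc (-(N : ℤ)) N)
      fun n hn => by simp only [ha, if_neg hn, zero_mul]]
    exact Finset.sum_congr rfl fun n hn => by simp only [ha, if_pos hn]
  have hJa : Summable fun n => J n * (a (n + 1) - a n) := by
    refine (hfin'.sub (hfin J)).congr fun n => ?_
    ring
  -- Inner edges give minus a dissipation, dropped except at k. The two boundary edges see a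
  -- potential cut off at one end, and outer edges keep only the σ term.
  have hpt : ∀ n, J n * (a (n + 1) - a n) - σ * J n
      ≤ (if n = k then -dissipation c β (X t) k else 0) + tail N n := by
    intro n
    have hlp : ∀ m, Real.log ((X t).p m) ≤ 0 := fun m => Real.log_nonpos (hp m).le (hp1 m)
    have hxl : ∀ m, -((X t).p m * Real.log ((X t).p m)) ≤ 2 * √((X t).p m) := fun m =>
      neg_mul_log_le_two_mul_sqrt (hp m)
    have hu0 : 0 < rateUp c β (X t).L n := mul_pos (hβ₀ _) (Real.exp_pos _)
    have hd0 : 0 < rateDown c β (X t).M (n + 1) := mul_pos (hβ₀ _) (Real.exp_pos _)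
    have p1 := hp n
    have p2 := hp (n + 1)
    have q1 : -(σ * J n) ≤ e₁ t n := neg_le_abs _
    have q2 : 0 ≤ e₂ t n := by positivity
    have q3 : 0 ≤ e₃ t n := by positivity
    have q4 : 0 ≤ e₄ t n := by positivity
    have q5 : 0 ≤ e₅ t n := by positivity
    have q6 : e₁ t n + e₂ t n + e₃ t n + e₄ t n + e₅ t n ≤ U n :=
      (le_abs_self _).trans (hUb t htm n)
    by_cases hin : n ∈ Finset.Ico (-(N : ℤ)) N
    · have h1 : n ∈ Finset.Icc (-(N : ℤ)) N := by
        rw [Finset.mem_Ico] at hin; rw [Finset.mem_Icc]; omega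
      have h2 : n + 1 ∈ Finset.Icc (-(N : ℤ)) N := by
        rw [Finset.mem_Ico] at hin; rw [Finset.mem_Icc]; omega
      simp only [ha, if_pos h1, if_pos h2, tail, if_pos hin, add_zero]
      have h3 := dissipation_eq (c := c) hβ₀ hp n
      have h4 : J n * (l (n + 1) - l n) - σ * J n = -dissipation c β (X t) n := h3.symm
      rw [h4]
      split_ifs with hnk
      · rw [hnk]
      · have := dissipation_nonneg (c := c) hβ₀ hp n
        linarith
    · have hnk : n ≠ k := fun h => hin (h ▸ hk)
      simp only [if_neg hnk, tail, if_neg hin, zero_add]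
      refine le_trans ?_ q6
      have hJn : J n = rateUp c β (X t).L n * (X t).p n
        - rateDown c β (X t).M (n + 1) * (X t).p (n + 1) := rfl
      rw [Finset.mem_Ico, not_and_or] at hin
      by_cases h1 : n ∈ Finset.Icc (-(N : ℤ)) N
      · have h2 : n + 1 ∉ Finset.Icc (-(N : ℤ)) N := by
          rw [Finset.mem_Icc] at h1 ⊢; omega
        simp only [ha, if_pos h1, if_neg h2]
        have h3 := mul_le_mul_of_nonneg_left (hxl n) hu0.le
        have h4 : 0 ≤ rateUp c β (X t).L n * (X t).p n * (c * (n : ℝ) ^ 2) := by positivity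
        -- The product of p (n + 1) with log p n has no evident bound, but here it enters with the
        -- favourable sign.
        have h5 := mul_nonpos_of_nonneg_of_nonpos (mul_pos hd0 p2).le (hlp n)
        have h6 : J n * (0 - l n) ≤ e₂ t n + e₅ t n := by
          simp only [hJn, l, e₂, e₅]
          linarith
        linarith
      · by_cases h2 : n + 1 ∈ Finset.Icc (-(N : ℤ)) N
        · simp only [ha, if_neg h1, if_pos h2]
          have h3 := mul_le_mul_of_nonneg_left (hxl (n + 1)) hd0.le
          have h4 : 0 ≤ rateDown c β (X t).M (n + 1) * (X t).p (n + 1)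
            * (c * ((n + 1 : ℤ) : ℝ) ^ 2) := by positivity
          have h5 := mul_nonpos_of_nonneg_of_nonpos (mul_pos hu0 p1).le (hlp (n + 1))
          have h6 : J n * (l (n + 1) - 0) ≤ e₃ t n + e₄ t n := by
            simp only [hJn, l, e₃, e₄]
            linarith
          linarith
        · simp only [ha, if_neg h1, if_neg h2, sub_self, mul_zero]
          linarith
  have hk1 : HasSum (fun n => if n = k then -dissipation c β (X t) k else 0)
      (-dissipation c β (X t) k) := hasSum_ite_eq k _
  have hfinal := hasSum_le hpt (hJa.hasSum.sub (hJs.mul_left σ).hasSum)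
    (hk1.add (htails N).hasSum)
  rw [tsum_mul_left, ← hsum] at hfinal
  rw [hmean]
  linarith

lemma tendsto_sum_Icc {f : ℤ → ℝ} (hf : Summable f) :
    Tendsto (fun N : ℕ => ∑ n ∈ Finset.Icc (-(N : ℤ)) N, f n) atTop (𝓝 (∑' n, f n)) := by
  refine hf.hasSum.comp (tendsto_atTop_finset_of_monotone (fun M N h => ?_) fun n => ?_)
  · exact Finset.Icc_subset_Icc (by omega) (by omega)
  · exact ⟨n.natAbs, by rw [Finset.mem_Icc]; omega⟩

/-- The free energy decreases at least at the rate of dissipation across any fixed edge. -/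
lemma freeEnergy_le (hX : BoundedFlow c β C K R X) (hβ : ∀ n, |β n| ≤ b₁)
    (hβ₀ : ∀ n, 0 < β n) (hc : 0 < c) (k : ℤ) {s t δ : ℝ} (hs : 1 ≤ s) (hst : s ≤ t)
    (hδ : ∀ u ∈ Set.Icc s t, δ ≤ dissipation c β (X u) k) :
    freeEnergy c (X t) ≤ freeEnergy c (X s) - δ * (t - s) := by
  obtain ⟨ε, hε, hdec⟩ := hX.exists_deriv_truncated_le hβ hβ₀ hc k
  set G : ℕ → ℝ → ℝ := fun N u => ∑ n ∈ Finset.Icc (-(N : ℤ)) N, entropyTerm c n ((X u).p n)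
    + c * ((X u).L + (X u).M) ^ 2 / 2
  have hlim : ∀ u, 1 ≤ u → Tendsto (fun N => G N u) atTop (𝓝 (freeEnergy c (X u))) :=
    fun u hu => (tendsto_sum_Icc (hX.summable_entropyTerm hc hu)).add_const _
  have hG : ∀ N u, 1 ≤ u → HasDerivAt (G N)
      (∑ n ∈ Finset.Icc (-(N : ℤ)) N, (Real.log ((X u).p n) + c * (n : ℝ) ^ 2)
          * (flux c β (X u) (n - 1) - flux c β (X u) n)
        + c * ((X u).L + (X u).M) * (meanDown c β (X u) - meanUp c β (X u))) u := by
    intro N u hu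
    refine HasDerivAt.add (HasDerivAt.fun_sum fun n _ => ?_) ?_
    · exact (hasDerivAt_entropyTerm c n (hX.pos u hu n)).comp u (hX.deriv_p u hu n)
    · refine (((((hX.deriv_L u hu).add (hX.deriv_M u hu)).pow 2).const_mul c).div_const
        2).congr_deriv ?_
      simp only [Pi.add_apply]
      push_cast
      ring
  have h1 : Tendsto (fun N => G N s + (-δ + ε N) * (t - s)) atTop
      (𝓝 (freeEnergy c (X s) + (-δ + 0) * (t - s))) :=
    (hlim s hs).add ((hε.const_add (-δ)).mul_const _)
  have h2 := le_of_tendsto_of_tendsto (hlim t (hs.trans hst)) h1 (by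
    filter_upwards [eventually_gt_atTop k.natAbs] with N hN
    have hk : k ∈ Finset.Ico (-(N : ℤ)) N := by rw [Finset.mem_Ico]; omega
    have h3 := sub_le_of_hasDerivAt_le (C := -δ + ε N) hst
      (fun u hu => (hG N u (hs.trans hu.1)).continuousAt.continuousWithinAt)
      (fun u hu => hG N u (hs.trans hu.1.le)) (fun u hu => by
        have h4 := hdec N hk u (hs.trans hu.1.le)
        have h5 := hδ u (Set.Ioo_subset_Icc_self hu)
        linarith)
    linarith)
  linarith

/-- The free energy falls at least at rate flux²/Q, with Q above both one-way fluxes, and the flux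
is Lipschitz because its time derivative is bounded; `tendsto_zero_of_dissipation` applies. -/
lemma tendsto_flux (hX : BoundedFlow c β C K R X) (hβ : ∀ n, |β n| ≤ b₁)
    (hβ₀ : ∀ n, 0 < β n) (hc : 0 < c) (k : ℤ) :
    Tendsto (fun t => flux c β (X t) k) atTop (𝓝 0) := by
  have bounded : ∀ {u : ℝ → ℤ → ℝ}, RapidOn (Set.Ici 1) u → ∃ B, 0 ≤ B ∧
      ∀ t, 1 ≤ t → ∀ n, |u t n| ≤ B := fun {u} hu => by
    obtain ⟨B, hB, hb⟩ := hu 0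
    exact ⟨B, hB, fun t ht n => by simpa using hb t ht n⟩
  have hU : TemperedOn (Set.Ici 1) fun t n => rateUp c β (X t).L n :=
    temperedOn_rateUp hβ hX.abs_L_le
  have hD : TemperedOn (Set.Ici 1) fun t n => rateDown c β (X t).M n :=
    temperedOn_rateDown hβ hX.abs_M_le
  have hJ := hX.rapidOn_flux hβ
  have hdJ : RapidOn (Set.Ici 1) fun t n => flux c β (X t) (n - 1) - flux c β (X t) n :=
    (hJ.shift (-1)).sub hJ
  obtain ⟨B₁, hB₁, hb₁⟩ := bounded (hU.mul_rapid hX.rapid)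
  obtain ⟨B₂, hB₂, hb₂⟩ := bounded (hD.mul_rapid hX.rapid)
  obtain ⟨B₃, hB₃, hb₃⟩ := bounded (hU.mul_rapid hdJ)
  obtain ⟨B₄, hB₄, hb₄⟩ := bounded (hD.mul_rapid hdJ)
  have hβn : ∀ n, 0 ≤ β n := fun n => (hβ₀ n).le
  have hC' : ∀ t, 1 ≤ t → |C - meanUp c β (X t)| ≤ |C| + R := fun t ht => by
    have h1 := meanUp_nonneg (c := c) hβn (hX.prob t ht).1
    have h2 := hX.meanUp_le t ht
    rw [abs_le]
    constructor <;> linarith [le_abs_self C, neg_abs_le C]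
  have hM' : ∀ t, 1 ≤ t → |meanDown c β (X t) - C| ≤ |C| + R := fun t ht => by
    have h1 := meanDown_nonneg (c := c) hβn (hX.prob t ht).1
    have h2 := hX.meanDown_le t ht
    rw [abs_le]
    constructor <;> linarith [le_abs_self C, neg_abs_le C]
  have hderiv : ∀ t, 1 ≤ t → HasDerivAt (fun t => flux c β (X t) k)
      (c * (C - meanUp c β (X t)) * (rateUp c β (X t).L k * (X t).p k)
        + rateUp c β (X t).L k * (flux c β (X t) (k - 1) - flux c β (X t) k)
        - (-(c * (meanDown c β (X t) - C)) * (rateDown c β (X t).M (k + 1) * (X t).p (k + 1))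
        + rateDown c β (X t).M (k + 1)
          * (flux c β (X t) (k + 1 - 1) - flux c β (X t) (k + 1)))) t := by
    intro t ht
    have h1 := ((((hX.deriv_L t ht).const_sub (k : ℝ)).const_mul (-c)).exp.const_mul (β k)).mul
      (hX.deriv_p t ht k)
    have h2 := ((((hX.deriv_M t ht).const_sub ((k + 1 : ℤ) : ℝ)).const_mul c).exp.const_mul
      (β (k + 1 - 1))).mul (hX.deriv_p t ht (k + 1))
    refine (h1.sub h2).congr_deriv ?_
    simp only [rateUp, rateDown]
    ring
  set B := c * (|C| + R) * B₁ + B₃ + (c * (|C| + R) * B₂ + B₄)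
  have hlip : ∀ s t, 1 ≤ s → s ≤ t → |flux c β (X t) k - flux c β (X s) k| ≤ B * (t - s) := by
    intro s t hs hst
    have h := (convex_Icc s t).norm_image_sub_le_of_norm_hasDerivWithin_le
      (f := fun t => flux c β (X t) k) (C := B)
      (fun u hu => (hderiv u (hs.trans hu.1)).hasDerivWithinAt) (fun u hu => by
        have hu1 := hs.trans hu.1
        refine (abs_sub _ _).trans (add_le_add ((abs_add_le _ _).trans (add_le_add ?_ ?_))
          ((abs_add_le _ _).trans (add_le_add ?_ ?_)))
        · rw [abs_mul, abs_mul, abs_of_pos hc]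
          exact mul_le_mul (mul_le_mul_of_nonneg_left (hC' u hu1) hc.le) (hb₁ u hu1 k)
            (abs_nonneg _) (mul_nonneg hc.le ((abs_nonneg _).trans (hC' u hu1)))
        · exact hb₃ u hu1 k
        · rw [abs_mul, abs_neg, abs_mul, abs_of_pos hc]
          exact mul_le_mul (mul_le_mul_of_nonneg_left (hM' u hu1) hc.le) (hb₂ u hu1 (k + 1))
            (abs_nonneg _) (mul_nonneg hc.le ((abs_nonneg _).trans (hM' u hu1)))
        · exact hb₄ u hu1 (k + 1))
      (Set.left_mem_Icc.2 hst) (Set.right_mem_Icc.2 hst)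
    rwa [Real.norm_eq_abs, Real.norm_eq_abs, abs_of_nonneg (sub_nonneg.2 hst)] at h
  set Q := B₁ + B₂ + 1
  have hQ : 0 < Q := by positivity
  refine tendsto_zero_of_dissipation (F := fun t => freeEnergy c (X t)) (inv_pos.2 hQ)
    (fun t ht => hX.freeEnergy_nonneg hc ht) hlip fun s t δ hs hst hδ => ?_
  refine hX.freeEnergy_le hβ hβ₀ hc k hs hst fun u hu => ?_
  have hu1 := hs.trans hu.1
  have h1 : δ / Q ≤ flux c β (X u) k ^ 2 / Q := by
    have := hδ u hu; gcongr
  have h2 : flux c β (X u) k ^ 2 / Q ≤ dissipation c β (X u) k :=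
    sq_sub_div_le_mul_log_sub_log
      (mul_pos (mul_pos (hβ₀ _) (Real.exp_pos _)) (hX.pos u hu1 k))
      (mul_pos (mul_pos (hβ₀ _) (Real.exp_pos _)) (hX.pos u hu1 (k + 1)))
      (by linarith [le_abs_self (rateUp c β (X u).L k * (X u).p k), hb₁ u hu1 k])
      (by linarith [le_abs_self (rateDown c β (X u).M (k + 1) * (X u).p (k + 1)),
        hb₂ u hu1 (k + 1)])
  rw [inv_mul_eq_div]
  exact h1.trans h2

end BoundedFlow

/-! ### Detailed balance -/

section Balance

variable {c : ℝ} {β : ℤ → ℝ} {x y : WalkState}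

/-- A zero of p would spread through balance to both neighbours, hence to all of ℤ, contradicting
total mass 1. -/
lemma pos_of_flux_eq_zero (hβ₀ : ∀ n, 0 < β n) (hp : IsProbVec x.p)
    (h : ∀ n, flux c β x n = 0) (n : ℤ) : 0 < x.p n := by
  have hU : ∀ n, 0 < rateUp c β x.L n := fun n => mul_pos (hβ₀ _) (Real.exp_pos _)
  have hD : ∀ n, 0 < rateDown c β x.M n := fun n => mul_pos (hβ₀ _) (Real.exp_pos _)
  have up : ∀ n, x.p n = 0 → x.p (n + 1) = 0 := fun n hn => by
    have h1 := h n
    rw [flux, hn, mul_zero, zero_sub, neg_eq_zero] at h1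
    exact (mul_eq_zero.1 h1).resolve_left (hD _).ne'
  have down : ∀ n, x.p n = 0 → x.p (n - 1) = 0 := fun n hn => by
    have h1 := h (n - 1)
    rw [flux, sub_add_cancel, hn, mul_zero, sub_zero] at h1
    exact (mul_eq_zero.1 h1).resolve_left (hU _).ne'
  refine lt_of_le_of_ne (hp.1 n) fun hn => ?_
  have hall : ∀ m, x.p m = 0 := fun m => by
    induction m using Int.inductionOn' (b := n) with
    | zero => exact hn.symm
    | succ k _ ih => exact up k ih
    | pred k _ ih => exact down k ih
  have := hp.2
  simp only [funext hall] at this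
  exact zero_ne_one (hasSum_zero.unique this)

/-- States in detailed balance are discrete Gaussians centred at `(L + M) / 2`. -/
lemma log_p_of_flux_eq_zero (hβ₀ : ∀ n, 0 < β n) (hp : IsProbVec x.p)
    (h : ∀ n, flux c β x n = 0) (n : ℤ) :
    Real.log (x.p n) = Real.log (x.p 0) + c * (x.L + x.M) * n - c * (n : ℝ) ^ 2 := by
  have hpos := pos_of_flux_eq_zero hβ₀ hp h
  have step : ∀ n : ℤ, Real.log (x.p (n + 1))
      = Real.log (x.p n) + c * (x.L + x.M) - c * (2 * n + 1) := fun n => by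
    have h1 := congrArg Real.log (sub_eq_zero.1 (h n))
    rw [log_rateUp_mul hβ₀ _ _ (hpos n), log_rateDown_mul hβ₀ _ _ (hpos (n + 1))] at h1
    linarith
  induction n using Int.inductionOn' (b := 0) with
  | zero => simp
  | succ k _ ih => rw [step, ih]; push_cast; ring
  | pred k _ ih =>
    have h1 := step (k - 1)
    rw [sub_add_cancel, ih] at h1
    push_cast at h1 ⊢
    linarith

lemma p_eq_of_flux_eq_zero (hβ₀ : ∀ n, 0 < β n) (hp : IsProbVec x.p)
    (h : ∀ n, flux c β x n = 0) (n : ℤ) :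
    x.p n = x.p 0 * Real.exp (c * (x.L + x.M) * n - c * (n : ℝ) ^ 2) := by
  have hpos := pos_of_flux_eq_zero hβ₀ hp h
  rw [← Real.exp_log (hpos n), log_p_of_flux_eq_zero hβ₀ hp h n, add_sub_assoc, Real.exp_add,
    Real.exp_log (hpos 0)]

lemma rapidOn_of_flux_eq_zero (hc : 0 < c) (hβ₀ : ∀ n, 0 < β n) (hp : IsProbVec x.p)
    (h : ∀ n, flux c β x n = 0) (α : ℝ) :
    RapidOn Set.univ fun _ n => x.p n * weightB c α n := by
  set S := c * (x.L + x.M) with hS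
  -- Of the decay exp(-cn²), half pays for the weight and half remains as a Gaussian gain. The
  -- linear parameter cancels α and dominates the tilt S n.
  refine rapidOn_of_mul_weightB_le (α := -(|S| + α)) (B := x.p 0) hc fun _ _ n => ?_
  have hpos := pos_of_flux_eq_zero hβ₀ hp h
  rw [abs_of_pos (mul_pos (hpos n) (weightB_pos c α n)), p_eq_of_flux_eq_zero hβ₀ hp h n,
    weightB, weightB, mul_assoc, mul_assoc, ← Real.exp_add, ← Real.exp_add]
  refine mul_le_of_le_one_right (hpos 0).le (Real.exp_le_one_iff.2 ?_)
  have h1 : S * n ≤ |S| * |(n : ℝ)| := by rw [← abs_mul]; exact le_abs_self _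
  rw [← hS]
  linarith

lemma memB_of_flux_eq_zero (hc : 0 < c) (hβ₀ : ∀ n, 0 < β n) (hp : IsProbVec x.p)
    (h : ∀ n, flux c β x n = 0) (α : ℝ) : MemB c α x.p := by
  have := (rapidOn_of_flux_eq_zero hc hβ₀ hp h α).summable (Set.mem_univ (0 : ℝ))
  refine this.congr fun n => ?_
  rw [abs_of_nonneg (hp.1 n)]

lemma rapidOn_p_of_flux_eq_zero (hc : 0 < c) (hβ₀ : ∀ n, 0 < β n) (hp : IsProbVec x.p)
    (h : ∀ n, flux c β x n = 0) : RapidOn Set.univ fun _ => x.p :=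
  rapidOn_of_mul_weightB_le (α := 0) hc fun _ _ =>
    (memB_of_flux_eq_zero hc hβ₀ hp h 0).mul_weightB_le

/-- A probability measure in detailed balance is determined by `L + M + ∑ n p_n`. -/
lemma eq_of_flux_eq_zero (hc : 0 < c) (hβ₀ : ∀ n, 0 < β n) (hp : IsProbVec x.p)
    (hq : IsProbVec y.p) (hx : ∀ n, flux c β x n = 0) (hy : ∀ n, flux c β y n = 0)
    (hK : x.L + x.M + meanPos x = y.L + y.M + meanPos y) :
    x.p = y.p ∧ x.L + x.M = y.L + y.M := by
  set A := Real.log (x.p 0) - Real.log (y.p 0)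
  set Δ := (x.L + x.M) - (y.L + y.M) with hΔ
  have hpp := pos_of_flux_eq_zero hβ₀ hp hx
  have hqp := pos_of_flux_eq_zero hβ₀ hq hy
  -- The difference of the logarithms is the affine function A + cΔn. With equal masses and equal K
  -- its pairing with x.p - y.p is -cΔ², whereas each term is nonnegative.
  have hsum : HasSum (fun n => (x.p n - y.p n) * (Real.log (x.p n) - Real.log (y.p n)))
      (-(c * Δ ^ 2)) := by
    have h := (hasSum_affine hp (rapidOn_p_of_flux_eq_zero hc hβ₀ hp hx) A (c * Δ)).sub
      (hasSum_affine hq (rapidOn_p_of_flux_eq_zero hc hβ₀ hq hy) A (c * Δ))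
    have e : A + c * Δ * meanPos x - (A + c * Δ * meanPos y) = -(c * Δ ^ 2) := by
      have : meanPos x - meanPos y = -Δ := by rw [hΔ]; linarith
      linear_combination c * Δ * this
    rw [e] at h
    refine h.congr_fun fun n => ?_
    rw [log_p_of_flux_eq_zero hβ₀ hp hx n, log_p_of_flux_eq_zero hβ₀ hq hy n]
    simp only [A, Δ]; ring
  have hnn : ∀ n, 0 ≤ (x.p n - y.p n) * (Real.log (x.p n) - Real.log (y.p n)) := fun n =>
    mul_log_sub_log_nonneg (hpp n) (hqp n)
  have h0 : c * Δ ^ 2 = 0 := le_antisymm (by linarith [hsum.nonneg hnn]) (by positivity)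
  have hΔ0 : Δ = 0 := by simpa [hc.ne'] using h0
  rw [h0, neg_zero] at hsum
  refine ⟨funext fun n => ?_, by linarith⟩
  by_contra hne
  have h1 := congrFun ((hasSum_zero_iff_of_nonneg hnn).1 hsum) n
  exact (mul_log_sub_log_pos (hpp n) (hqp n) hne).ne' h1

/-- Moving L and M oppositely multiplies all rates by one constant, so detailed balance and L + M
survive. This freedom adjusts the mean rates of a limit point. -/
lemma flux_translate (c : ℝ) (β : ℤ → ℝ) (L M h : ℝ) (p : ℤ → ℝ) (n : ℤ) :
    flux c β ⟨L + h, M - h, p⟩ n = Real.exp (c * h) * flux c β ⟨L, M, p⟩ n := by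
  simp only [flux, rateUp_eq, rateDown_eq]
  rw [mul_add c L h, Real.exp_add, show -(c * (M - h)) = -(c * M) + c * h by ring, Real.exp_add]
  ring

/-- Stationarity makes the flux constant in n, and a summable constant on ℤ is zero. -/
lemma IsFixedPoint.flux_eq_zero {Clam Cmu : ℝ} (hx : IsFixedPoint c β Clam Cmu x) (n : ℤ) :
    flux c β x n = 0 := by
  have hstep : ∀ n, flux c β x (n - 1) = flux c β x n := fun n => by
    have := hx.field_p n
    rw [fieldP_eq_flux_sub] at this
    exact sub_eq_zero.1 this
  have hconst : ∀ m, flux c β x m = flux c β x n := fun m => by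
    induction m using Int.inductionOn' (b := n) with
    | zero => rfl
    | succ k _ ih => rw [← hstep (k + 1), add_sub_cancel_right, ih]
    | pred k _ ih => rw [hstep, ih]
  have hs : Summable (flux c β x) := by
    refine (hx.summable_up.sub (summable_int_shift hx.summable_down 1)).congr fun m => ?_
    rw [flux]; ring
  exact (summable_const_iff _).1 (hs.congr hconst)

end Balance

/-! ### Convergence -/

namespace BoundedFlow

variable {c : ℝ} {β : ℤ → ℝ} {C K R b₁ : ℝ} {X : ℝ → WalkState}

lemma tendsto_moment (hX : BoundedFlow c β C K R X) {a : ℤ → ℝ}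
    (ha : TemperedOn Set.univ fun _ => a) {l : Filter ℝ} (hl : l ≤ atTop) {q : ℤ → ℝ}
    (hq : ∀ n, Tendsto (fun t => (X t).p n) l (𝓝 (q n))) :
    Tendsto (fun t => ∑' n, a n * (X t).p n) l (𝓝 (∑' n, a n * q n)) :=
  ((ha.mono (Set.subset_univ (Set.Ici 1))).mul_rapid hX.rapid).tendsto_tsum
    (hl (eventually_ge_atTop 1)) fun n => (hq n).const_mul (a n)

/-- Limit points of a bounded trajectory are in detailed balance. -/
lemma exists_limit (hX : BoundedFlow c β C K R X) (hβ : ∀ n, |β n| ≤ b₁)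
    (hβ₀ : ∀ n, 0 < β n) (hc : 0 < c) (U : Ultrafilter ℝ) (hU : (U : Filter ℝ) ≤ atTop) :
    ∃ x : WalkState, IsProbVec x.p ∧ (∀ n, flux c β x n = 0) ∧ x.L + x.M + meanPos x = K ∧
      Tendsto (fun t => (X t).L + (X t).M) U (𝓝 (x.L + x.M)) ∧
      ∀ n, Tendsto (fun t => (X t).p n) U (𝓝 (x.p n)) := by
  have hge : ∀ᶠ t in (U : Filter ℝ), 1 ≤ t := hU (eventually_ge_atTop 1)
  have hcpt : ∀ (f : ℝ → ℝ) (B : ℝ), (∀ t, 1 ≤ t → |f t| ≤ B) →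
      ∃ l, Tendsto f U (𝓝 l) := fun f B hf => by
    have h1 : ((U.map f : Ultrafilter ℝ) : Filter ℝ) ≤ 𝓟 (Set.Icc (-B) B) := by
      rw [le_principal_iff]
      exact hge.mono fun t ht => abs_le.1 (hf t ht)
    obtain ⟨l, -, hl⟩ := isCompact_Icc.ultrafilter_le_nhds _ h1
    exact ⟨l, hl⟩
  obtain ⟨L, hL⟩ := hcpt _ R hX.abs_L_le
  obtain ⟨M, hM⟩ := hcpt _ R hX.abs_M_le
  -- All coordinates converge along the same ultrafilter, so no diagonal extraction is needed.
  choose p hp using fun n => hcpt (fun t => (X t).p n) 1 fun t ht => by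
    rw [abs_of_nonneg ((hX.prob t ht).1 n)]; exact (hX.prob t ht).le_one n
  have hsumm : RapidOn Set.univ fun _ => p := fun k => by
    obtain ⟨Q, hQ, hb⟩ := hX.rapid k
    exact ⟨Q, hQ, fun _ _ n => le_of_tendsto (hp n).abs (hge.mono fun t ht => hb t ht n)⟩
  refine ⟨⟨L, M, p⟩, ⟨fun n => ge_of_tendsto (hp n) (hge.mono fun t ht => (hX.prob t ht).1 n), ?_⟩,
    fun n => ?_, ?_, hL.add hM, hp⟩
  · have h1 := hX.tendsto_moment (a := fun _ => 1) (temperedOn_const 1) hU hp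
    have h2 : Tendsto (fun t => ∑' n, 1 * (X t).p n) U (𝓝 1) :=
      tendsto_const_nhds.congr' (hge.mono fun t ht => by
        simp only [one_mul, (hX.prob t ht).2.tsum_eq])
    have h3 := tendsto_nhds_unique h1 h2
    simp only [one_mul] at h3
    exact h3 ▸ (hsumm.summable (Set.mem_univ (0 : ℝ))).hasSum
  · have h1 : Tendsto (fun t => flux c β (X t) n) U (𝓝 (flux c β ⟨L, M, p⟩ n)) := by
      have hu : Tendsto (fun t => rateUp c β (X t).L n) U (𝓝 (rateUp c β L n)) :=
        (((Real.continuous_exp.tendsto _).comp ((hL.const_sub (n : ℝ)).const_mul (-c)))).const_mul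
          (β n)
      have hd : Tendsto (fun t => rateDown c β (X t).M (n + 1)) U (𝓝 (rateDown c β M (n + 1))) :=
        (((Real.continuous_exp.tendsto _).comp
          ((hM.const_sub ((n + 1 : ℤ) : ℝ)).const_mul c))).const_mul (β (n + 1 - 1))
      exact (hu.mul (hp n)).sub (hd.mul (hp (n + 1)))
    exact tendsto_nhds_unique h1 ((hX.tendsto_flux hβ hβ₀ hc n).mono_left hU)
  · have h1 := hX.tendsto_moment (a := fun n => (n : ℝ)) temperedOn_intCast hU hp
    have h2 := (hL.add hM).add h1
    have h3 : Tendsto (fun t => (X t).L + (X t).M + ∑' n : ℤ, (n : ℝ) * (X t).p n) U (𝓝 K) :=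
      tendsto_const_nhds.congr' (hge.mono fun t ht => (hX.conserved t ht).symm)
    exact tendsto_nhds_unique h2 h3

/-- `L` converges as soon as `p` does, because `e^{-cL}` solves a linear equation. -/
lemma tendsto_L (hX : BoundedFlow c β C K R X) (hβ : ∀ n, |β n| ≤ b₁) (hc : 0 < c) (hC : 0 < C)
    {x : WalkState} (hmean : meanUp c β x = C)
    (hp : ∀ n, Tendsto (fun t => (X t).p n) atTop (𝓝 (x.p n))) :
    Tendsto (fun t => (X t).L) atTop (𝓝 x.L) := by
  set a : ℤ → ℝ := fun n => β n * Real.exp (-c * (n : ℝ))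
  have ha : TemperedOn Set.univ fun _ => a :=
    (TemperedOn.of_bounded fun _ _ => hβ).mul (temperedOn_exp_mul _)
  have hA := (hX.tendsto_moment ha le_rfl hp).const_mul c
  set y : ℝ → ℝ := fun t => Real.exp (-(c * (X t).L))
  have hexp : ∀ L : ℝ, Real.exp (-(c * L)) * Real.exp (c * L) = 1 := fun L => by
    rw [← Real.exp_add]; simp
  have hy : ∀ t, 1 ≤ t → HasDerivAt y (-(c * C * y t) + c * ∑' n, a n * (X t).p n) t := by
    intro t ht
    refine ((hX.deriv_L t ht).const_mul c).neg.exp.congr_deriv ?_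
    rw [meanUp_eq_exp_mul]
    simp only [Pi.neg_apply, y, a]
    linear_combination (c * ∑' n, a n * (X t).p n) * hexp (X t).L
  -- Time is shifted by one because the equation for y is available only from time 1 on.
  have hy1 : Tendsto (fun t => y (t + 1)) atTop (𝓝 ((c * ∑' n, a n * x.p n) / (c * C))) := by
    exact tendsto_of_hasDerivAt_affine (y := fun t => y (t + 1))
      (f := fun t => c * ∑' n, a n * (X (t + 1)).p n) (mul_pos hc hC)
      (fun t ht => (hy (t + 1) (by linarith)).comp_add_const t 1)
      (hA.comp (tendsto_atTop_add_const_right atTop 1 tendsto_id))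
  have hy2 : Tendsto y atTop (𝓝 (Real.exp (-(c * x.L)))) := by
    have h1 : (c * ∑' n, a n * x.p n) / (c * C) = Real.exp (-(c * x.L)) := by
      rw [meanUp_eq_exp_mul] at hmean
      field_simp
      linear_combination (-∑' n, a n * x.p n) * hexp x.L + Real.exp (-(c * x.L)) * hmean
    rw [← h1]
    refine (hy1.comp (tendsto_atTop_add_const_right atTop (-1) tendsto_id)).congr fun t => ?_
    simp
  have h3 := (hy2.log (Real.exp_pos _).ne').const_mul (-(1 / c))
  simp only [y, Real.log_exp] at h3
  have h4 : ∀ L : ℝ, -(1 / c) * -(c * L) = L := fun L => by field_simp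
  simpa only [h4] using h3

end BoundedFlow

section Final

variable {c α : ℝ} {β : ℤ → ℝ} {Clam Cmu : ℝ} {X : ℝ → WalkState} {b₀ b₁ R : ℝ}

lemma IsSolution.exists_boundedFlow (hX : IsSolution c α β Clam Cmu X) (hc : 0 < c)
    (hb₀ : 0 < b₀) (hβ₀ : ∀ n, b₀ ≤ β n) (hβ : ∀ n, |β n| ≤ b₁)
    (hpos : 0 < Clam) (heq : Clam = Cmu) {C : ℝ} (hC : 0 < C)
    (hup : ∀ n, Real.exp (-c) * β (n + 1) - β n ≤ -C)
    (hdn : ∀ n, Real.exp (-c) * β (n - 1) - β n ≤ -C)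
    (hprob : ∀ t, 0 ≤ t → IsProbVec (X t).p) :
    ∃ R, BoundedFlow c β Clam (conservedK (X 0)) R X := by
  obtain ⟨R, hR⟩ := hX.exists_bounds hc hb₀ hβ₀ hβ hpos heq hC hup hdn hprob
  obtain ⟨E, hE⟩ := hX.exists_normB_le hc hb₀ hβ₀ hβ hprob
    fun t ht => ⟨(hR t ht).1, (hR t ht).2.1⟩
  have h0 : ∀ {t : ℝ}, 1 ≤ t → 0 < t := fun ht => one_pos.trans_le ht
  exact ⟨R,
    { rapid := rapidOn_of_mul_weightB_le hc fun t ht n =>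
        ((hX.memB t (h0 ht).le).mul_weightB_le n).trans (hE t ht)
      prob := fun t ht => hprob t (h0 ht).le
      pos := fun t ht => hX.p_pos (fun n => hb₀.trans_le (hβ₀ n)) hprob (h0 ht)
      abs_L_le := fun t ht => (hR t ht).1
      abs_M_le := fun t ht => (hR t ht).2.1
      meanUp_le := fun t ht => (hR t ht).2.2.1
      meanDown_le := fun t ht => (hR t ht).2.2.2
      deriv_p := fun t ht => hX.hasDerivAt_p (h0 ht)
      deriv_L := fun t ht => (hX.hasDerivAt_L (h0 ht)).congr_deriv (by rw [fieldL_eq]; ring)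
      deriv_M := fun t ht => (hX.hasDerivAt_M (h0 ht)).congr_deriv (by rw [fieldM_eq, heq])
      conserved := fun t ht => hX.conservedK_eq hc hβ heq (h0 ht).le }⟩

/-- Pointwise convergence upgrades to convergence in norm. -/
lemma IsSolution.tendsto_normB (hX : IsSolution c α β Clam Cmu X) (hc : 0 < c)
    (hb₀ : 0 < b₀) (hβ₀ : ∀ n, b₀ ≤ β n) (hβ : ∀ n, |β n| ≤ b₁)
    (hprob : ∀ t, 0 ≤ t → IsProbVec (X t).p)
    (hR : ∀ t, 1 ≤ t → |(X t).L| ≤ R ∧ |(X t).M| ≤ R) {q : ℤ → ℝ}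
    (hq : ∀ n, Tendsto (fun t => (X t).p n) atTop (𝓝 (q n))) :
    Tendsto (fun t => normB c α ((X t).p - q)) atTop (𝓝 0) := by
  rw [Metric.tendsto_atTop']
  intro ε hε
  obtain ⟨r, hr⟩ := hX.exists_tail_le hc hb₀ hβ₀ hβ hprob hR (ε := ε / 4) (by positivity)
  -- The limit inherits the tail bound through finite sums.
  have hqr : ∀ A : Finset ℤ, (∀ n ∈ A, (r : ℝ) ≤ |(n : ℝ)|) →
      ∑ n ∈ A, |q n| * weightB c α n ≤ ε / 4 := fun A hA =>
    le_of_tendsto (tendsto_finsetSum A fun n _ => (hq n).abs.mul_const (weightB c α n))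
      (hr.mono fun t ht => ht A hA)
  have hcore : Tendsto (fun t => ∑ n ∈ Finset.Icc (-(r : ℤ)) r,
      |(X t).p n - q n| * weightB c α n) atTop (𝓝 0) := by
    have := tendsto_finsetSum (Finset.Icc (-(r : ℤ)) r) fun n _ =>
      (((hq n).sub_const (q n)).abs.mul_const (weightB c α n))
    simpa using this
  obtain ⟨t₀, ht₀⟩ := eventually_atTop.1
    (hr.and (hcore.eventually_le_const (u := ε / 4) (by positivity)))
  refine ⟨t₀, fun t ht => ?_⟩
  obtain ⟨h1, h2⟩ := ht₀ t ht.le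
  rw [Real.dist_eq, sub_zero, abs_of_nonneg (normB_nonneg _ _ _)]
  have hw : ∀ n, 0 ≤ weightB c α n := fun n => (weightB_pos c α n).le
  have : normB c α ((X t).p - q) ≤ ε / 4 + (ε / 4 + ε / 4) := by
    refine Real.tsum_le_of_sum_le (fun n => mul_nonneg (abs_nonneg _) (hw n)) fun A => ?_
    rw [← Finset.sum_filter_add_sum_filter_not A (fun n => n ∈ Finset.Icc (-(r : ℤ)) r)]
    refine add_le_add (le_trans ?_ h2) ?_
    · exact Finset.sum_le_sum_of_subset_of_nonneg (fun n hn => (Finset.mem_filter.1 hn).2)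
        fun n _ _ => mul_nonneg (abs_nonneg _) (hw n)
    · have hout : ∀ n ∈ A.filter fun n => n ∉ Finset.Icc (-(r : ℤ)) r,
          (r : ℝ) ≤ |(n : ℝ)| := fun n hn => by
        have h3 := (Finset.mem_filter.1 hn).2
        rw [Finset.mem_Icc, ← abs_le, not_le] at h3
        exact_mod_cast h3.le
      refine le_trans ?_ (add_le_add (h1 _ hout) (hqr _ hout))
      rw [← Finset.sum_add_distrib]
      refine Finset.sum_le_sum fun n _ => ?_
      rw [← add_mul]
      exact mul_le_mul_of_nonneg_right (abs_sub _ _) (hw n)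
  linarith

end Final

end

/-! ### Assembly of the theorem -/

theorem theorem4 (c α : ℝ) (hc : 0 < c) (β : ℤ → ℝ)
    (hβ₁ : ConBounded β) (hβ₂ : ConDrift c β)
    (Clam Cmu : ℝ) (hpos : 0 < Clam) (heq : Clam = Cmu)
    (x₀ : WalkState) (hprob : IsProbVec x₀.p) (hB : MemB c α x₀.p)
    (X : ℝ → WalkState) (hX : IsSolution c α β Clam Cmu X) (hX0 : X 0 = x₀) :
    ∃ x : WalkState,
      (IsFixedPoint c β Clam Cmu x ∧ conservedK x = conservedK x₀) ∧
      (∀ y : WalkState,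
        IsFixedPoint c β Clam Cmu y → conservedK y = conservedK x₀ → y = x) ∧
      MemB c α x.p ∧
      Tendsto (fun t => normB c α ((X t).p - x.p)) atTop (𝓝 0) ∧
      Tendsto (fun t => (X t).L) atTop (𝓝 x.L) ∧
      Tendsto (fun t => (X t).M) atTop (𝓝 x.M) := by
  subst hX0
  obtain ⟨⟨b₀, hb₀, hlo⟩, D, hD, hdr⟩ := hβ₂
  obtain ⟨b₁, hb₁⟩ := hβ₁
  have hβpos : ∀ n, 0 < β n := fun n => hb₀.trans_le (hlo n)
  have hβ : ∀ n, |β n| ≤ b₁ := fun n => by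
    rw [abs_of_pos (hβpos n)]; exact hb₁ ⟨n, rfl⟩
  have hprobt : ∀ t, 0 ≤ t → IsProbVec (X t).p := fun t ht =>
    hX.isProbVec hc hβ (fun n => (hβpos n).le) hprob ht
  obtain ⟨R, hF⟩ := hX.exists_boundedFlow hc hb₀ hlo hβ hpos heq hD
    (fun n => (hdr n).1.le) (fun n => (hdr n).2.le) hprobt
  -- A limit point of the trajectory supplies the Gaussian with the prescribed K, so no equation for
  -- its centre has to be solved.
  obtain ⟨z, hz, hzflux, hzK, -⟩ := hF.exists_limit hβ hβpos hc (Ultrafilter.of atTop)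
    (Ultrafilter.of_le _)
  set A := ∑' n : ℤ, β n * Real.exp (-c * (n : ℝ)) * z.p n with hA
  have hApos : 0 < A := by
    have ha : TemperedOn Set.univ fun _ n => β n * Real.exp (-c * (n : ℝ)) :=
      (TemperedOn.of_bounded fun _ _ => hβ).mul (temperedOn_exp_mul _)
    have hpt : ∀ n, 0 < β n * Real.exp (-c * (n : ℝ)) * z.p n := fun n =>
      mul_pos (mul_pos (hβpos n) (Real.exp_pos _)) (pos_of_flux_eq_zero hβpos hz hzflux n)
    exact ((ha.mul_rapid (rapidOn_p_of_flux_eq_zero hc hβpos hz hzflux)).summable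
      (Set.mem_univ (0 : ℝ))).tsum_pos (fun n => (hpt n).le) 0 (hpt 0)
  -- Chosen so that the mean up-rate exp(cL)·A equals Clam. Moving M oppositely keeps L + M, hence K
  -- and the balance.
  set L := Real.log (Clam / A) / c with hL
  set x : WalkState := ⟨z.L + (L - z.L), z.M - (L - z.L), z.p⟩ with hx
  have hxL : x.L = L := by simp [hx]
  have hxS : x.L + x.M = z.L + z.M := by simp only [hx]; ring
  have hxp : x.p = z.p := rfl
  have hxprob : IsProbVec x.p := hz
  have hxflux : ∀ n, flux c β x n = 0 := fun n => by
    have := flux_translate c β z.L z.M (L - z.L) z.p n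
    rw [show flux c β ⟨z.L, z.M, z.p⟩ n = 0 from hzflux n, mul_zero] at this
    exact this
  have hxrapid := rapidOn_p_of_flux_eq_zero hc hβpos hxprob hxflux
  have hxmean : x.L + x.M + meanPos x = conservedK (X 0) := by rw [hxS]; exact hzK
  have hxup : meanUp c β x = Clam := by
    rw [meanUp_eq_exp_mul, hxL, hxp, ← hA, hL, mul_div_cancel₀ _ hc.ne',
      Real.exp_log (div_pos hpos hApos), div_mul_cancel₀ _ hApos.ne']
  -- Zero total flux equates the two mean rates.
  have hxdown : meanDown c β x = Clam := by
    have h := tsum_flux (c := c) hβ hxrapid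
    simp only [hxflux, tsum_zero] at h
    linarith
  -- Another ultrafilter may give different values of L and M, but by `eq_of_flux_eq_zero` the same
  -- p and the same sum.
  have hlim : ∀ U : Ultrafilter ℝ, (U : Filter ℝ) ≤ atTop →
      Tendsto (fun t => (X t).L + (X t).M) U (𝓝 (x.L + x.M)) ∧
        ∀ n, Tendsto (fun t => (X t).p n) U (𝓝 (x.p n)) := fun U hU => by
    obtain ⟨w, hw, hwflux, hwK, hwS, hwp⟩ := hF.exists_limit hβ hβpos hc U hU
    obtain ⟨e1, e2⟩ := eq_of_flux_eq_zero hc hβpos hw hxprob hwflux hxflux (hwK.trans hxmean.symm)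
    rw [← e1, ← e2]
    exact ⟨hwS, hwp⟩
  have hpt : ∀ n, Tendsto (fun t => (X t).p n) atTop (𝓝 (x.p n)) := fun n =>
    (tendsto_iff_ultrafilter _ _ _).2 fun U hU => (hlim U hU).2 n
  have hS : Tendsto (fun t => (X t).L + (X t).M) atTop (𝓝 (x.L + x.M)) :=
    (tendsto_iff_ultrafilter _ _ _).2 fun U hU => (hlim U hU).1
  have hLlim := hF.tendsto_L hβ hc hpos hxup hpt
  refine ⟨x, ⟨⟨hxprob, summable_p hxrapid (temperedOn_rateUp_const hβ _),
    summable_p hxrapid (temperedOn_rateDown_const hβ _), fun n => ?_, ?_, ?_⟩, hxmean⟩,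
    fun y hy hyK => ?_, memB_of_flux_eq_zero hc hβpos hxprob hxflux α,
    hX.tendsto_normB hc hb₀ hlo hβ hprobt (fun t ht => ⟨hF.abs_L_le t ht, hF.abs_M_le t ht⟩) hpt,
    hLlim, ?_⟩
  · rw [fieldP_eq_flux_sub, hxflux, hxflux, sub_zero]
  · rw [fieldL_eq, hxup]; ring
  · rw [fieldM_eq, hxdown, heq, sub_self]
  · obtain ⟨e1, e2⟩ := eq_of_flux_eq_zero hc hβpos hy.prob hxprob hy.flux_eq_zero hxflux
      (hyK.trans hxmean.symm)
    have hyup : meanUp c β y = Clam := by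
      have := hy.field_L
      rw [fieldL_eq] at this
      linarith
    -- With p fixed, the mean up-rate is strictly increasing in L.
    have hyL : y.L = x.L := by
      rw [← hxup, meanUp_eq_exp_mul, meanUp_eq_exp_mul, e1, hxp, ← hA] at hyup
      exact mul_left_cancel₀ hc.ne' (Real.exp_injective (mul_right_cancel₀ hApos.ne' hyup))
    exact WalkState.ext hyL (by linarith) e1
  · simpa using hS.sub hLlim
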